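/- Let $p$ be a prime, let $L$ be a finite extension of $\mathbb{Q}_p$, and let $\mathcal{O}$ be the ring of integers of $L$ and $k$ its residue field. A ring $R$ of finite Krull dimension is called equidimensional if $\dim R/\mathfrak{p} = \dim R$ for every minimal prime $\mathfrak{p}$ of $R$. Let $A$ and $B$ be $\mathcal{O}$-torsion-free complete local noetherian $\mathcal{O}$-algebras with residue field $k$, with maximal ideals $\mathfrak{m}_A$ and $\mathfrak{m}_B$, and let $$A \widehat{\otimes}_{\mathcal{O}} B = \varprojlim_{n} \,(A \otimes_{\mathcal{O}} B)/(\mathfrak{m}_A \otimes B + A \otimes \mathfrak{m}_B)^n$$ be their completed tensor product, where $\mathfrak{m}_A \otimes B + A \otimes \mathfrak{m}_B$ denotes the ideal of $A \otimes_{\mathcal{O}} B$ generated by the images of $\mathfrak{m}_A$ and $\mathfrak{m}_B$. If $A$ and $B$ are both equidimensional, then $A \widehat{\otimes}_{\mathcal{O}} B$ is equidimensional, of dimension $\dim A + \dim B - 1$. -/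

import Mathlib

open scoped TensorProduct

/-- A commutative ring of finite Krull dimension is equidimensional if `dim R / 𝔭 = dim R` for every
minimal prime `𝔭` of `R`. -/
structure IsEquidimensional (R : Type*) [CommRing R] : Prop where
  finite_dim : FiniteRingKrullDim R
  dim_quotient_eq : ∀ 𝔭 ∈ minimalPrimes R, ringKrullDim (R ⧸ 𝔭) = ringKrullDim R

/-- The ideal `𝔪_A ⊗ B + A ⊗ 𝔪_B` of `A ⊗[O] B`, for local `O`-algebras `A` and `B`. -/
def tensorMaximalIdeal (O A B : Type*) [CommRing O] [CommRing A] [CommRing B] [Algebra O A]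
    [Algebra O B] [IsLocalRing A] [IsLocalRing B] : Ideal (A ⊗[O] B) :=
  (IsLocalRing.maximalIdeal A).map
      (Algebra.TensorProduct.includeLeft : A →ₐ[O] A ⊗[O] B) ⊔
    (IsLocalRing.maximalIdeal B).map
      (Algebra.TensorProduct.includeRight : B →ₐ[O] A ⊗[O] B)

/-- The completed tensor product of two local `O`-algebras: the completion of `A ⊗[O] B` with
respect to the ideal `𝔪_A ⊗ B + A ⊗ 𝔪_B`. The powers of this ideal are cofinal with the ideals
`𝔪_A ^ i ⊗ B + A ⊗ 𝔪_B ^ j`, so this is the inverse limit of the rings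
`A / 𝔪_A ^ i ⊗ B / 𝔪_B ^ j`. -/
abbrev CompletedTensorProduct (O A B : Type*) [CommRing O] [CommRing A] [CommRing B] [Algebra O A]
    [Algebra O B] [IsLocalRing A] [IsLocalRing B] : Type _ :=
  AdicCompletion (tensorMaximalIdeal O A B) (A ⊗[O] B)

/-- The ring of integers of a finite extension `L` of `ℚ_[p]`. -/
abbrev PadicIntegers (p : ℕ) [Fact p.Prime] (L : Type*) [Field L] [Algebra ℤ_[p] L] : Type _ :=
  integralClosure ℤ_[p] L

/-- For a local ring `O` with residue field `k`: `A` is an `O`-torsion-free complete local noetherian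
`O`-algebra with residue field `k`. As `O` is local, surjectivity of `O → A / 𝔪_A` says exactly that
this map has kernel the maximal ideal of `O` and induces an isomorphism from `k` to `A / 𝔪_A`. -/
structure IsTorsionFreeCompleteLocalAlgebra (O A : Type*) [CommRing O] [CommRing A]
    [IsLocalRing A] [Algebra O A] : Prop where
  noetherian : IsNoetherianRing A
  complete : IsAdicComplete (IsLocalRing.maximalIdeal A) A
  torsionFree : Module.IsTorsionFree O A
  residueField : Function.Surjective (algebraMap O (IsLocalRing.ResidueField A))

/-! Take ϖ = p. It is regular on A, so lifting a system of parameters of A/ϖ makes A finite over a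
power series ring S = O⟦X_1, …, X_a⟧ with dim A = a + 1; likewise B is finite over T = O⟦Y_1, …,
Y_b⟧. The completed tensor product R is then finite over U = O⟦X, Y⟧, which has dimension a + b + 1,
and everything reduces to the injectivity of U → R/q for each minimal prime q
(`ker_quotient_minimalPrime_eq_bot`).

The contractions of q to A and B contain minimal primes P and Q. By equidimensionality dim A/P = dim
S, so S → A/P is injective and the torsion-free S-module A/P embeds in some S^n; likewise B/Q embeds
in some T^m (`exists_isFreeEmbedding_of_ringKrullDim_eq`). With K = P ⊗ B + A ⊗ Q, the quotient R/KR
should embed in U^(nm), hence be torsion-free over U. But q is minimal over KR, so a nonzero u in U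
mapping into q would kill a nonzero element of R/KR.

Torsion-freeness (`mem_sup_of_mul_mem`) is proved by approximation inside A ⊗ B, not by exactness of
completed tensor products. The maps `pairing` from A ⊗ B to U multiply coordinates of the two
embeddings, and `exists_mem_of_pairing_mem` shows that an element whose pairings are all (ϖ, X,
Y)-adically small lies in K + I^i, where I is the ideal being completed along. This rests on
Artin–Rees and on flatness of submodules of free modules over the Dedekind domain O. Krull's
intersection theorem then removes the error term. -/

/-! ### Power series: the X-adic filtration and evaluation in complete rings -/

namespace MvPowerSeries

variable {σ τ O : Type*} [CommRing O]

/-- The ideal `(ϖ, X_i)` of a ring of formal power series, extended from polynomials. -/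
noncomputable def paramIdeal (σ : Type*) (ϖ : O) : Ideal (MvPolynomial σ O) :=
  Ideal.span {MvPolynomial.C ϖ} ⊔ MvPolynomial.idealOfVars σ O

theorem map_idealOfVars :
    (MvPolynomial.idealOfVars σ O).map (MvPolynomial.coeToMvPowerSeries.ringHom) =
      Ideal.span (Set.range (X : σ → MvPowerSeries σ O)) := by
  rw [MvPolynomial.idealOfVars, Ideal.map_span, ← Set.range_comp]
  congr 2
  ext1 i
  simp

theorem mem_span_X_pow_iff [Finite σ] (n : ℕ) (f : MvPowerSeries σ O) :
    f ∈ Ideal.span (Set.range (X : σ → MvPowerSeries σ O)) ^ n ↔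
      ∀ e : σ →₀ ℕ, e.degree < n → coeff e f = 0 := by
  constructor
  · intro hf e he
    rw [← map_idealOfVars, ← Ideal.map_pow, Ideal.map] at hf
    induction hf using Submodule.span_induction generalizing e with
    | mem x hx =>
      obtain ⟨q, hq, rfl⟩ := hx
      simpa using (MvPolynomial.mem_pow_idealOfVars_iff' n q).mp hq e he
    | zero => simp
    | add x y _ _ hx hy => simp [hx e he, hy e he]
    | smul a x _ hx =>
      classical
      rw [smul_eq_mul, coeff_mul]
      refine Finset.sum_eq_zero fun p hp => ?_
      rw [hx p.2, mul_zero]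
      have := Finset.HasAntidiagonal.mem_antidiagonal.mp hp
      have h2 : p.1.degree + p.2.degree = e.degree := by rw [← this]; simp
      omega
  · intro h
    -- Power series are the completion of polynomials along the finitely generated ideal of
    -- variables, where the kernel of reduction mod the n-th power is generated by that power.
    let ψ := (toAdicCompletionAlgEquiv σ O)
    have h1 : (ψ f).val n = 0 := by
      rw [toAdicCompletionAlgEquiv_apply, toAdicCompletion_apply_eq_mk_truncTotal]
      have : truncTotal n f = 0 := by
        ext e
        rw [coeff_truncTotal_eq_ite]
        split_ifs with he
        · simpa using h e he
        · simp
      rw [this]; rfl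
    have h2 : ψ f ∈ (MvPolynomial.idealOfVars σ O ^ n • ⊤ :
        Submodule (MvPolynomial σ O) (AdicCompletion _ (MvPolynomial σ O))) := by
      rw [AdicCompletion.pow_smul_top_eq_ker_eval (MvPolynomial.idealOfVars_fg σ O)]
      exact h1
    have h3 : f ∈ Ideal.map (algebraMap (MvPolynomial σ O) (MvPowerSeries σ O))
        (MvPolynomial.idealOfVars σ O ^ n) := by
      have := Submodule.mem_map_of_mem (f := ψ.symm.toLinearMap) h2
      rw [Submodule.map_smul''] at this
      simpa using this
    rw [← map_idealOfVars, ← Ideal.map_pow]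
    exact h3

/-- The variables are disjoint, so an exponent on `σ ⊕ τ` splits in only one way into a part on σ
and a part on τ. -/
theorem coeff_rename_inl_mul_rename_inr [Finite σ] [Finite τ] (f : MvPowerSeries σ O)
    (g : MvPowerSeries τ O) (a : σ →₀ ℕ) (b : τ →₀ ℕ) :
    coeff (a.embDomain Function.Embedding.inl + b.embDomain Function.Embedding.inr)
      (rename (Function.Embedding.inl : σ ↪ σ ⊕ τ) f *
        rename (Function.Embedding.inr : τ ↪ σ ⊕ τ) g) = coeff a f * coeff b g := by
  classical
  rw [coeff_mul, Finset.sum_eq_single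
    (a.embDomain Function.Embedding.inl, b.embDomain Function.Embedding.inr)]
  · rw [coeff_embDomain_rename, coeff_embDomain_rename]
  · rintro ⟨u, v⟩ h hne
    by_contra hc
    apply hne
    have hu : u ∈ Set.range (Finsupp.mapDomain (Function.Embedding.inl : σ ↪ σ ⊕ τ)) := by
      by_contra h'
      exact hc (by rw [coeff_rename_eq_zero _ _ h', zero_mul])
    have hv : v ∈ Set.range (Finsupp.mapDomain (Function.Embedding.inr : τ ↪ σ ⊕ τ)) := by
      by_contra h'
      exact hc (by rw [coeff_rename_eq_zero _ g h', mul_zero])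
    obtain ⟨u, rfl⟩ := hu
    obtain ⟨v, rfl⟩ := hv
    rw [← Finsupp.embDomain_eq_mapDomain, ← Finsupp.embDomain_eq_mapDomain] at *
    have h := Finset.HasAntidiagonal.mem_antidiagonal.mp h
    simp only at h
    have h1 : u = a := by
      ext i
      have := DFunLike.congr_fun h (Function.Embedding.inl i)
      simp only [Finsupp.add_apply, Finsupp.embDomain_apply_self] at this
      rw [Finsupp.embDomain_of_notMem_range _ _ _ (by simp),
        Finsupp.embDomain_of_notMem_range _ _ _ (by simp)] at this
      simpa using this
    have h2 : v = b := by
      ext i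
      have := DFunLike.congr_fun h (Function.Embedding.inr i)
      simp only [Finsupp.add_apply, Finsupp.embDomain_apply_self] at this
      rw [Finsupp.embDomain_of_notMem_range _ _ _ (by simp),
        Finsupp.embDomain_of_notMem_range _ _ _ (by simp)] at this
      simpa using this
    rw [h1, h2]
  · intro h
    refine absurd ?_ h
    rw [Finset.HasAntidiagonal.mem_antidiagonal]

theorem exists_algHom_aeval_truncTotal [Finite σ] {E : Type*} [CommRing E] [Algebra O E]
    (I : Ideal E) [IsAdicComplete I E] (z : σ → E) (hz : ∀ i, z i ∈ I) :
    ∃ φ : MvPowerSeries σ O →ₐ[O] E, (∀ i, φ (X i) = z i) ∧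
      ∀ (n : ℕ) (f : MvPowerSeries σ O),
        φ f - MvPolynomial.aeval z (truncTotal n f) ∈ I ^ n := by
  have hle (n : ℕ) : MvPolynomial.idealOfVars σ O ^ n ≤
      (I ^ n).comap (MvPolynomial.aeval z : MvPolynomial σ O →ₐ[O] E) := by
    rw [← Ideal.map_le_iff_le_comap, Ideal.map_pow]
    refine Ideal.pow_right_mono ?_ n
    rw [MvPolynomial.idealOfVars, Ideal.map_span, Ideal.span_le]
    rintro _ ⟨_, ⟨i, rfl⟩, rfl⟩
    simpa using hz i
  let F (n : ℕ) : MvPowerSeries σ O →ₐ[O] E ⧸ I ^ n :=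
    (Ideal.quotientMapₐ (I ^ n) (MvPolynomial.aeval z) (hle n)).comp
      ((truncTotalAlgHom σ O n).restrictScalars O)
  have hF (n : ℕ) (f : MvPowerSeries σ O) :
      F n f = Ideal.Quotient.mk _ (MvPolynomial.aeval z (truncTotal n f)) := rfl
  have hF' {m n : ℕ} (h : m ≤ n) :
      (Ideal.Quotient.factorₐ O (Ideal.pow_le_pow_right h)).comp (F n) = F m := by
    refine AlgHom.ext fun f => ?_
    rw [AlgHom.comp_apply, hF, hF]
    change Ideal.Quotient.mk _ _ = _
    rw [Ideal.Quotient.mk_eq_mk_iff_sub_mem, ← map_sub]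
    exact hle m (truncTotal_sub_truncTotal_mem_pow_idealOfVars h le_rfl f)
  have key (n : ℕ) (f : MvPowerSeries σ O) :
      IsAdicComplete.liftAlgHom I F hF' f - MvPolynomial.aeval z (truncTotal n f) ∈ I ^ n := by
    rw [← Ideal.Quotient.mk_eq_mk_iff_sub_mem, IsAdicComplete.mk_liftAlgHom, hF]
  refine ⟨IsAdicComplete.liftAlgHom I F hF', fun i => ?_, key⟩
  rw [← sub_eq_zero]
  refine (inferInstance : IsHausdorff I E).haus _ fun n => ?_
  rw [SModEq.zero, smul_eq_mul, Ideal.mul_top]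
  -- Truncation must keep degree 1 even when n = 0, hence n + 2.
  have h := key (n + 2) (X i)
  have hX : truncTotal (n + 2) (X i : MvPowerSeries σ O) = MvPolynomial.X i := by
    cases subsingleton_or_nontrivial O
    · exact Subsingleton.elim _ _
    rw [← MvPolynomial.coe_X, truncTotal_coe_eq_self_iff _ (by omega), MvPolynomial.totalDegree_X]
    omega
  rw [hX, MvPolynomial.aeval_X] at h
  exact Ideal.pow_le_pow_right (by omega) h

end MvPowerSeries

/-! ### Nakayama's lemma over a complete ring -/

theorem Submodule.mem_smul_top_pi_iff {U ι : Type*} [CommRing U] [Finite ι] (J : Ideal U)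
    (x : ι → U) : x ∈ (J • ⊤ : Submodule U (ι → U)) ↔ ∀ i, x i ∈ J := by
  classical
  cases nonempty_fintype ι
  constructor
  · intro hx i
    have := Submodule.mem_map_of_mem (f := LinearMap.proj (R := U) (φ := fun _ : ι => U) i) hx
    rw [Submodule.map_smul''] at this
    simpa using Submodule.smul_mono le_rfl le_top this
  · intro h
    rw [pi_eq_sum_univ x]
    exact Submodule.sum_mem _ fun i _ => Submodule.smul_mem_smul (h i) trivial

theorem IsPrecomplete.pi_self {U ι : Type*} [CommRing U] [Finite ι] (J : Ideal U)
    [hJ : IsPrecomplete J U] : IsPrecomplete J (ι → U) := by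
  refine ⟨fun f hf => ?_⟩
  have h (i : ι) : ∃ l : U, ∀ n, f n i ≡ l [SMOD (J ^ n • ⊤ : Submodule U U)] := by
    refine hJ.prec (f := fun n => f n i) fun {m n} hmn => ?_
    have := (Submodule.mem_smul_top_pi_iff _ _).mp (SModEq.sub_mem.mp (hf hmn)) i
    rw [SModEq.sub_mem]
    simpa using this
  choose l hl using h
  refine ⟨l, fun n => ?_⟩
  rw [SModEq.sub_mem, Submodule.mem_smul_top_pi_iff]
  intro i
  simpa using SModEq.sub_mem.mp (hl i n)

theorem Module.Finite.of_isPrecomplete_of_isHausdorff {U M ι : Type*} [CommRing U]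
    [AddCommGroup M] [Module U M] [Finite ι] (J : Ideal U) [IsPrecomplete J U] [IsHausdorff J M]
    (e : ι → M) (h : Submodule.span U (Set.range e) ⊔ J • ⊤ = ⊤) : Module.Finite U M := by
  cases nonempty_fintype ι
  have := IsPrecomplete.pi_self (ι := ι) J
  refine Module.Finite.of_surjective (Fintype.linearCombination U e)
    (surjective_of_mkQ_comp_surjective (I := J) ?_)
  rw [← LinearMap.range_eq_top, LinearMap.range_comp, Fintype.range_linearCombination,
    Submodule.map_mkQ_eq_top, sup_comm, h]

/-! ### The (ϖ, X)-adic topology and the dimension of power series rings -/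

namespace MvPowerSeries

variable {σ O : Type*} [CommRing O] [Finite σ] (ϖ : O)

omit [Finite σ] in
theorem map_paramIdeal : (paramIdeal σ ϖ).map (MvPolynomial.coeToMvPowerSeries.ringHom) =
    Ideal.span {C ϖ} ⊔ Ideal.span (Set.range (X : σ → MvPowerSeries σ O)) := by
  rw [paramIdeal, Ideal.map_sup, map_idealOfVars, Ideal.map_span, Set.image_singleton]
  congr 3
  simp

/-- This uses (ϖ, X)^(b+a) ⊆ (ϖ^b) + (X)^a; the second summand has no terms of degree below a. -/
theorem coeff_mem_of_mem_pow_add {a b : ℕ} {f : MvPowerSeries σ O}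
    (hf : f ∈ ((paramIdeal σ ϖ).map MvPolynomial.coeToMvPowerSeries.ringHom) ^ (b + a))
    {e : σ →₀ ℕ} (he : e.degree < a) : coeff e f ∈ Ideal.span {ϖ} ^ b := by
  rw [map_paramIdeal] at hf
  obtain ⟨g, hg, h, hh, rfl⟩ := Submodule.mem_sup.mp (Ideal.sup_pow_add_le_pow_sup_pow hf)
  rw [map_add, (mem_span_X_pow_iff a h).mp hh e he, add_zero]
  rw [Ideal.span_singleton_pow, Ideal.mem_span_singleton] at hg ⊢
  obtain ⟨g, rfl⟩ := hg
  rw [← map_pow, coeff_C_mul]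
  exact dvd_mul_right _ _

theorem mem_pow_of_coeff_mem {n : ℕ} {f : MvPowerSeries σ O}
    (hf : ∀ e : σ →₀ ℕ, e.degree < n → coeff e f ∈ Ideal.span {ϖ} ^ n) :
    f ∈ ((paramIdeal σ ϖ).map MvPolynomial.coeToMvPowerSeries.ringHom) ^ n := by
  have h1 : f - (truncTotal n f : MvPowerSeries σ O) ∈
      ((paramIdeal σ ϖ).map MvPolynomial.coeToMvPowerSeries.ringHom) ^ n := by
    rw [map_paramIdeal]
    refine Ideal.pow_right_mono le_sup_right n ?_
    rw [mem_span_X_pow_iff]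
    intro e he
    rw [map_sub, MvPolynomial.coeff_coe, coeff_truncTotal _ he, sub_self]
  have h2 : truncTotal n f ∈ paramIdeal σ ϖ ^ n := by
    refine Ideal.pow_right_mono le_sup_left n ?_
    rw [← Set.image_singleton, ← Ideal.map_span, ← Ideal.map_pow, MvPolynomial.mem_map_C_iff]
    intro e
    rw [coeff_truncTotal_eq_ite]
    split_ifs with he
    · exact hf e he
    · exact zero_mem _
  rw [← sub_add_cancel f (truncTotal n f : MvPowerSeries σ O)]
  refine add_mem h1 ?_
  rw [← Ideal.map_pow]
  exact Ideal.mem_map_of_mem _ h2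

theorem isPrecomplete_paramIdeal [hO : IsPrecomplete (Ideal.span {ϖ}) O] :
    IsPrecomplete ((paramIdeal σ ϖ).map MvPolynomial.coeToMvPowerSeries.ringHom)
      (MvPowerSeries σ O) := by
  refine ⟨fun f hf => ?_⟩
  simp only [SModEq.sub_mem, smul_eq_mul, Ideal.mul_top] at hf ⊢
  -- The limit is built coefficientwise. The shift by deg e + 1 pays for passing from (ϖ, X)-adic
  -- closeness of series to ϖ-adic closeness of their e-th coefficients.
  have h (e : σ →₀ ℕ) : ∃ l : O, ∀ n,
      coeff e (f (n + (e.degree + 1))) ≡ l [SMOD (Ideal.span {ϖ} ^ n • ⊤ : Submodule O O)] := by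
    refine hO.prec (f := fun n => coeff e (f (n + (e.degree + 1)))) fun {m n} hmn => ?_
    simp only [SModEq.sub_mem, smul_eq_mul, Ideal.mul_top]
    rw [← map_sub]
    exact coeff_mem_of_mem_pow_add ϖ (hf (by omega)) (by omega)
  choose l hl using h
  let L : MvPowerSeries σ O := fun e => l e
  have hL (e) : coeff e L = l e := rfl
  refine ⟨L, fun n => ?_⟩
  -- Index 2n suffices: for deg e < n, removing the shift deg e + 1 leaves at least n.
  rw [← sub_add_sub_cancel _ (f (2 * n))]
  refine add_mem (hf (by omega)) (mem_pow_of_coeff_mem ϖ fun e he => ?_)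
  have := SModEq.sub_mem.mp (hl e (2 * n - (e.degree + 1)))
  rw [Nat.sub_add_cancel (by omega), smul_eq_mul, Ideal.mul_top] at this
  rw [map_sub, hL]
  exact Ideal.pow_le_pow_right (by omega) this

/-- Upper bound: the variables lie in the Jacobson radical and cut the ring down to O. Lower bound:
each new variable raises the dimension by at least one. -/
theorem ringKrullDim_eq_add_card [IsNoetherianRing O] :
    ringKrullDim (MvPowerSeries σ O) = ringKrullDim O + Nat.card σ := by
  apply le_antisymm
  · cases nonempty_fintype σ
    classical
    have hj : ((Finset.univ.image (X : σ → MvPowerSeries σ O) : Finset _) : Set _) ⊆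
        (Ring.jacobson (MvPowerSeries σ O) : Set (MvPowerSeries σ O)) := by
      have := IsAdicComplete.le_jacobson_bot
        (Ideal.span (Set.range (X : σ → MvPowerSeries σ O)))
      rw [Finset.coe_image, Finset.coe_univ, Set.image_univ, ← Ideal.span_le,
        Ring.jacobson_eq_sInf_isMaximal]
      refine this.trans (le_of_eq ?_)
      simp [Ideal.jacobson]
    refine (ringKrullDim_le_ringKrullDim_quotient_add_card _ hj).trans ?_
    have hker : RingHom.ker (constantCoeff (σ := σ) (R := O)) ≤
        Ideal.span ((Finset.univ.image (X : σ → MvPowerSeries σ O) : Finset _) : Set _) := by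
      intro f hf
      rw [Finset.coe_image, Finset.coe_univ, Set.image_univ]
      rw [← pow_one (Ideal.span _), mem_span_X_pow_iff]
      intro e he
      obtain rfl : e = 0 := (Finsupp.degree_eq_zero_iff e).mp (by omega)
      simpa using hf
    gcongr
    · refine ringKrullDim_le_of_surjective ((Ideal.Quotient.mk _).comp C) fun y => ?_
      obtain ⟨f, rfl⟩ := Ideal.Quotient.mk_surjective y
      refine ⟨constantCoeff f, ?_⟩
      rw [RingHom.comp_apply, Ideal.Quotient.mk_eq_mk_iff_sub_mem]
      exact hker (by simp [RingHom.mem_ker])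
    · rw [Nat.card_eq_fintype_card]
      exact Finset.card_image_le
  · induction σ using Finite.induction_empty_option with
    | of_equiv e H =>
      rw [← Nat.card_congr e]
      exact H.trans_eq (ringKrullDim_eq_of_ringEquiv (renameEquiv O e).toRingEquiv)
    | h_empty =>
      simpa using (ringKrullDim_eq_of_ringEquiv (isEmptyEquiv (R := O) PEmpty).toRingEquiv).ge
    | h_option IH =>
      simp only [Nat.card_eq_fintype_card, Fintype.card_option, Nat.cast_add, Nat.cast_one,
        ← add_assoc] at IH ⊢
      grw [IH, ringKrullDim_succ_le_ringKrullDim_powerseries]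
      exact (ringKrullDim_eq_of_ringEquiv (optionEquivLeft _ _).toRingEquiv).ge

end MvPowerSeries

/-! ### Integral extensions, torsion-free modules and Artin–Rees -/

theorem ringKrullDim_le_of_isIntegral (R S : Type*) [CommRing R] [CommRing S] [Algebra R S]
    [Algebra.IsIntegral R S] : ringKrullDim S ≤ ringKrullDim R :=
  Order.krullDim_le_of_strictMono (PrimeSpectrum.comap (algebraMap R S)) fun p q h =>
    Ideal.IsIntegral.comap_lt_comap (R := R) (I := p.asIdeal) (J := q.asIdeal) h

theorem ringKrullDim_eq_of_isIntegral_of_injective {R S : Type*} [CommRing R] [CommRing S]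
    [Algebra R S] [Algebra.IsIntegral R S] (h : Function.Injective (algebraMap R S)) :
    ringKrullDim S = ringKrullDim R := by
  refine le_antisymm (ringKrullDim_le_of_isIntegral R S) (iSup_le fun l => ?_)
  obtain ⟨P, -, hP, hPl⟩ := Ideal.exists_ideal_over_prime_of_isIntegral
    l.head.asIdeal (⊥ : Ideal S)
    (by rw [← RingHom.ker_eq_comap_bot, (RingHom.injective_iff_ker_eq_bot _).mp h]; exact bot_le)
  have : P.LiesOver l.head.asIdeal := ⟨hPl.symm⟩
  obtain ⟨L, hL, -⟩ := Ideal.exists_ltSeries_of_hasGoingUp l P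
  rw [← hL]
  exact le_iSup (fun p : LTSeries (PrimeSpectrum S) => (p.length : WithBot ℕ∞)) L

/-- Choose a maximal independent subfamily of the generators. A nonzero multiple of each generator
lies in its free span, so the product of these multipliers carries M injectively into it. -/
theorem Module.exists_injective_to_pi (S M : Type*) [CommRing S] [IsDomain S] [AddCommGroup M]
    [Module S M] [Module.Finite S M] [Module.IsTorsionFree S M] :
    ∃ (n : ℕ) (f : M →ₗ[S] (Fin n → S)), Function.Injective f := by
  classical
  obtain ⟨k, v, hv⟩ := Module.Finite.exists_fin (R := S) (M := M)
  obtain ⟨s, hs, hmax⟩ := exists_maximal_linearIndepOn S v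
  have h (i : Fin k) : ∃ a : S, a ≠ 0 ∧ a • v i ∈ Submodule.span S (v '' s) := by
    by_cases hi : i ∈ s
    · exact ⟨1, one_ne_zero, (one_smul S (v i)).symm ▸ Submodule.subset_span (Set.mem_image_of_mem v hi)⟩
    · exact hmax i hi
  choose a ha hav using h
  have hd : ∏ i, a i ≠ 0 := Finset.prod_ne_zero_iff.mpr fun i _ => ha i
  have hmem (m : M) : (∏ i, a i) • m ∈ Submodule.span S (Set.range fun i : s => v i) := by
    have hm : m ∈ Submodule.span S (Set.range v) := hv ▸ Submodule.mem_top
    have hr : (Set.range fun i : s => v i) = v '' s := by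
      rw [Set.image_eq_range]
    rw [hr]
    induction hm using Submodule.span_induction with
    | mem x hx =>
      obtain ⟨i, rfl⟩ := hx
      rw [← Finset.prod_erase_mul _ _ (Finset.mem_univ i), mul_smul]
      exact Submodule.smul_mem _ _ (hav i)
    | zero => simp
    | add x y _ _ hx hy => rw [smul_add]; exact add_mem hx hy
    | smul c x _ hx => rw [smul_comm]; exact Submodule.smul_mem _ _ hx
  let g : M →ₗ[S] Submodule.span S (Set.range fun i : s => v i) :=
    (LinearMap.lsmul S M (∏ i, a i)).codRestrict _ hmem
  let e : (s →₀ S) ≃ₗ[S] (Fin (Fintype.card s) → S) :=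
    (Finsupp.linearEquivFunOnFinite S S s).trans
      (LinearEquiv.funCongrLeft S S (Fintype.equivFin s).symm)
  refine ⟨_, (e.toLinearMap ∘ₗ (LinearIndependent.repr hs)) ∘ₗ g, ?_⟩
  refine (e.injective.comp ?_).comp ?_
  · rw [← LinearMap.ker_eq_bot]
    exact LinearIndependent.repr_ker hs
  · intro x y hxy
    exact smul_right_injective M hd (congrArg Subtype.val hxy)

theorem Ideal.exists_pow_smul_top_inf_le {R M : Type*} [CommRing R] [IsNoetherianRing R]
    [AddCommGroup M] [Module R M] [Module.Finite R M] (J : Ideal R) (N : Submodule R M) (i : ℕ) :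
    ∃ d, J ^ d • ⊤ ⊓ N ≤ J ^ i • N := by
  obtain ⟨k, hk⟩ := Ideal.exists_pow_inf_eq_pow_smul J N
  refine ⟨i + k, ?_⟩
  rw [hk (i + k) (by omega), Nat.add_sub_cancel]
  exact Submodule.smul_mono le_rfl inf_le_right

/-- Artin–Rees applied to the range of f. Only the target has to be finite, which matters since A ⊗
B need not be finite over O. -/
theorem Submodule.exists_le_smul_of_map_mem {R M F : Type*} [CommRing R] [IsNoetherianRing R]
    [AddCommGroup M] [Module R M] [AddCommGroup F] [Module R F] [Module.Finite R F]
    (J : Ideal R) (f : M →ₗ[R] F) (i : ℕ) :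
    ∃ d, ∀ m, f m ∈ (J ^ d • ⊤ : Submodule R F) → m ∈ LinearMap.ker f ⊔ J ^ i • ⊤ := by
  obtain ⟨d, hd⟩ := Ideal.exists_pow_smul_top_inf_le J (LinearMap.range f) i
  refine ⟨d, fun m hm => ?_⟩
  have h := hd ⟨hm, LinearMap.mem_range_self f m⟩
  rw [LinearMap.range_eq_map, ← Submodule.map_smul''] at h
  obtain ⟨m', hm', hmm⟩ := h
  rw [← sub_add_cancel m m']
  exact add_mem (Submodule.mem_sup_left (by simp [LinearMap.mem_ker, hmm]))
    (Submodule.mem_sup_right hm')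

/-! ### Kernel of a tensor product of maps to free modules -/

section Coordinates

variable {O A B ι κ : Type*} [CommRing O] [AddCommGroup A] [AddCommGroup B] [Module O A]
  [Module O B] [Finite ι] [Finite κ]

/-- The coordinates of the tensor product of two linear maps to free modules. -/
noncomputable def tensorCoord (α : A →ₗ[O] (ι → O)) (β : B →ₗ[O] (κ → O)) :
    A ⊗[O] B →ₗ[O] (ι × κ → O) :=
  ((Pi.basisFun O ι).tensorProduct (Pi.basisFun O κ)).equivFun.toLinearMap ∘ₗ
    TensorProduct.map α β

theorem tensorCoord_tmul (α : A →ₗ[O] (ι → O)) (β : B →ₗ[O] (κ → O)) (a : A) (b : B) (i : ι)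
    (j : κ) : tensorCoord α β (a ⊗ₜ b) (i, j) = α a i * β b j := by
  simp [tensorCoord, mul_comm]

/-- The ranges of α and β are torsion-free, hence flat over O, so the kernel is unchanged when α and
β are replaced by surjections onto their ranges. Right exactness then gives ker α ⊗ B + A ⊗ ker β.
-/
theorem ker_tensorCoord_le [IsDedekindDomain O] (α : A →ₗ[O] (ι → O)) (β : B →ₗ[O] (κ → O))
    (N : Submodule O (A ⊗[O] B)) (hα : ∀ a b, α a = 0 → a ⊗ₜ b ∈ N)
    (hβ : ∀ a b, β b = 0 → a ⊗ₜ b ∈ N) : LinearMap.ker (tensorCoord α β) ≤ N := by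
  intro c hc
  have h1 : TensorProduct.map α β c = 0 :=
    ((Pi.basisFun O ι).tensorProduct (Pi.basisFun O κ)).equivFun.map_eq_zero_iff.mp hc
  have h2 : TensorProduct.map α.rangeRestrict β.rangeRestrict c = 0 := by
    apply TensorProduct.map_injective_of_flat_flat' (LinearMap.range α).subtype
      (LinearMap.range β).subtype (Submodule.subtype_injective _) (Submodule.subtype_injective _)
    rw [map_zero, ← LinearMap.comp_apply, ← TensorProduct.map_comp]
    exact h1
  rw [← LinearMap.mem_ker, TensorProduct.map_ker (LinearMap.exact_subtype_ker_map α.rangeRestrict)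
    α.surjective_rangeRestrict (LinearMap.exact_subtype_ker_map β.rangeRestrict)
    β.surjective_rangeRestrict] at h2
  refine (sup_le ?_ ?_ : _ ≤ N) h2
  · rintro _ ⟨x, rfl⟩
    induction x with
    | zero => simp
    | add x y hx hy => rw [map_add]; exact add_mem hx hy
    | tmul a b =>
      refine hβ a b ?_
      exact congrArg Subtype.val (LinearMap.mem_ker.mp b.2)
  · rintro _ ⟨x, rfl⟩
    induction x with
    | zero => simp
    | add x y hx hy => rw [map_add]; exact add_mem hx hy
    | tmul a b =>
      refine hα a b ?_
      exact congrArg Subtype.val (LinearMap.mem_ker.mp a.2)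

theorem exists_mem_of_tensorCoord_mem [IsDedekindDomain O] (α : A →ₗ[O] (ι → O))
    (β : B →ₗ[O] (κ → O)) (N : Submodule O (A ⊗[O] B)) (hα : ∀ a b, α a = 0 → a ⊗ₜ b ∈ N)
    (hβ : ∀ a b, β b = 0 → a ⊗ₜ b ∈ N) (J : Ideal O) (i : ℕ) (hJ : J ^ i • ⊤ ≤ N) :
    ∃ d, ∀ c, (∀ x, tensorCoord α β c x ∈ J ^ d) → c ∈ N := by
  obtain ⟨d, hd⟩ := Submodule.exists_le_smul_of_map_mem J (tensorCoord α β) i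
  refine ⟨d, fun c hc => ?_⟩
  exact sup_le (ker_tensorCoord_le α β N hα hβ) hJ
    (hd c ((Submodule.mem_smul_top_pi_iff _ _).mpr hc))

end Coordinates

/-! ### Free embeddings and the pairing into power series in both sets of variables -/

namespace MvPowerSeries

variable {σ τ O A B : Type*} [CommRing O] [Finite σ] [Finite τ] [CommRing A] [CommRing B]
  [Algebra O A] [Algebra O B]

/-- A linear map to a free module over a power series ring, that is semilinear along `φ`
and has kernel `P`. -/
structure IsFreeEmbedding (φ : MvPowerSeries σ O →ₐ[O] A) (P : Ideal A) {ι : Type*}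
    (f : A →ₗ[O] (ι → MvPowerSeries σ O)) : Prop where
  map_mul : ∀ s a, f (φ s * a) = s • f a
  eq_zero_iff : ∀ a, f a = 0 ↔ a ∈ P

/-- Artin–Rees over the power series ring: finitely many coefficients of f a determine a modulo P +
m^i. -/
theorem IsFreeEmbedding.exists_mem [IsNoetherianRing O] {φ : MvPowerSeries σ O →ₐ[O] A}
    {P : Ideal A} {ι : Type*} [Finite ι] {f : A →ₗ[O] (ι → MvPowerSeries σ O)}
    (hf : IsFreeEmbedding φ P f) {m : Ideal A} (hm : ∀ i, φ (X i) ∈ m) (i : ℕ) :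
    ∃ d, ∀ a, (∀ k (e : σ →₀ ℕ), e.degree < d → coeff e (f a k) = 0) → a ∈ P ⊔ m ^ i := by
  let _ : Algebra (MvPowerSeries σ O) A := φ.toRingHom.toAlgebra
  let g : A →ₗ[MvPowerSeries σ O] (ι → MvPowerSeries σ O) :=
    { toFun := f, map_add' := f.map_add, map_smul' := fun s a => hf.map_mul s a }
  obtain ⟨d, hd⟩ := Submodule.exists_le_smul_of_map_mem
    (Ideal.span (Set.range (X : σ → MvPowerSeries σ O))) g i
  refine ⟨d, fun a ha => ?_⟩
  have h1 : g a ∈ (Ideal.span (Set.range (X : σ → MvPowerSeries σ O)) ^ d • ⊤ :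
      Submodule (MvPowerSeries σ O) (ι → MvPowerSeries σ O)) := by
    rw [Submodule.mem_smul_top_pi_iff]
    exact fun k => (mem_span_X_pow_iff _ _).mpr (ha k)
  obtain ⟨x, hx, y, hy, rfl⟩ := Submodule.mem_sup.mp (hd a h1)
  refine Submodule.add_mem_sup ((hf.eq_zero_iff x).mp hx) ?_
  rw [Ideal.smul_top_eq_map, Ideal.map_pow, Ideal.map_span] at hy
  refine Ideal.pow_right_mono ?_ i hy
  rw [Ideal.span_le]
  rintro _ ⟨_, ⟨j, rfl⟩, rfl⟩
  exact hm j

variable {ι κ : Type*}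

/-- The map `A ⊗ B → O⟦σ ⊕ τ⟧`, `a ⊗ b ↦ f a k * g b l`. -/
noncomputable def pairing (f : A →ₗ[O] (ι → MvPowerSeries σ O))
    (g : B →ₗ[O] (κ → MvPowerSeries τ O)) (k : ι) (l : κ) :
    A ⊗[O] B →ₗ[O] MvPowerSeries (σ ⊕ τ) O :=
  LinearMap.mul' O _ ∘ₗ TensorProduct.map
    ((rename (R := O) (Function.Embedding.inl : σ ↪ σ ⊕ τ)).toLinearMap ∘ₗ LinearMap.proj k ∘ₗ f)
    ((rename (R := O) (Function.Embedding.inr : τ ↪ σ ⊕ τ)).toLinearMap ∘ₗ LinearMap.proj l ∘ₗ g)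

omit [Finite σ] [Finite τ] in
theorem pairing_tmul (f : A →ₗ[O] (ι → MvPowerSeries σ O))
    (g : B →ₗ[O] (κ → MvPowerSeries τ O)) (k : ι) (l : κ) (a : A) (b : B) :
    pairing f g k l (a ⊗ₜ b) = rename (Function.Embedding.inl : σ ↪ σ ⊕ τ) (f a k) *
      rename (Function.Embedding.inr : τ ↪ σ ⊕ τ) (g b l) := by
  simp [pairing]

/-- The images of the variables in `A ⊗ B`. -/
noncomputable def tensorParam (φ : MvPowerSeries σ O →ₐ[O] A) (ψ : MvPowerSeries τ O →ₐ[O] B) :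
    σ ⊕ τ → A ⊗[O] B :=
  Sum.elim (fun i => φ (X i) ⊗ₜ 1) (fun j => 1 ⊗ₜ ψ (X j))

variable {φ : MvPowerSeries σ O →ₐ[O] A} {ψ : MvPowerSeries τ O →ₐ[O] B} {P : Ideal A}
  {Q : Ideal B} {f : A →ₗ[O] (ι → MvPowerSeries σ O)} {g : B →ₗ[O] (κ → MvPowerSeries τ O)}

omit [Finite σ] [Finite τ] in
theorem pairing_aeval_mul (hf : IsFreeEmbedding φ P f) (hg : IsFreeEmbedding ψ Q g) (k : ι) (l : κ)
    (q : MvPolynomial (σ ⊕ τ) O) (c : A ⊗[O] B) :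
    pairing f g k l (MvPolynomial.aeval (tensorParam φ ψ) q * c) = q * pairing f g k l c := by
  induction q using MvPolynomial.induction_on generalizing c with
  | C r =>
    rw [MvPolynomial.algHom_C, ← Algebra.smul_def, map_smul, MvPolynomial.coe_C, smul_eq_C_mul]
  | add p q hp hq => rw [map_add, add_mul, map_add, hp, hq, MvPolynomial.coe_add, add_mul]
  | mul_X p i hp =>
    rw [map_mul (MvPolynomial.aeval _), mul_assoc, hp, MvPolynomial.aeval_X, MvPolynomial.coe_mul, mul_assoc,
      MvPolynomial.coe_X]
    congr 1
    induction c with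
    | zero => simp
    | add x y hx hy => rw [mul_add, map_add, map_add, mul_add, hx, hy]
    | tmul a b =>
      rcases i with i | j
      · rw [tensorParam, Sum.elim_inl, Algebra.TensorProduct.tmul_mul_tmul, pairing_tmul,
          pairing_tmul, hf.map_mul, one_mul, Pi.smul_apply, smul_eq_mul, map_mul, rename_X,
          mul_assoc]
        rfl
      · rw [tensorParam, Sum.elim_inr, Algebra.TensorProduct.tmul_mul_tmul, pairing_tmul,
          pairing_tmul, hg.map_mul, one_mul, Pi.smul_apply, smul_eq_mul, map_mul, rename_X,
          mul_left_comm]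
        rfl

omit [Finite σ] [Finite τ] in
theorem pairing_eq_zero (hf : IsFreeEmbedding φ P f) (hg : IsFreeEmbedding ψ Q g) (k : ι) (l : κ)
    {c : A ⊗[O] B} (hc : c ∈ P.map (Algebra.TensorProduct.includeLeft : A →ₐ[O] A ⊗[O] B) ⊔
      Q.map (Algebra.TensorProduct.includeRight : B →ₐ[O] A ⊗[O] B)) :
    pairing f g k l c = 0 := by
  obtain ⟨x, hx, y, hy, rfl⟩ := Submodule.mem_sup.mp hc
  have hx' (c) : pairing f g k l (x * c) = 0 := by
    clear hc
    induction hx using Submodule.span_induction generalizing c with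
    | mem x hx =>
      obtain ⟨a, ha, rfl⟩ := hx
      induction c with
      | zero => simp
      | add x y hx hy => rw [mul_add, map_add, hx, hy, add_zero]
      | tmul a' b =>
        simp [pairing_tmul, (hf.eq_zero_iff (a * a')).mpr (P.mul_mem_right _ ha)]
    | zero => simp
    | add x y _ _ hx hy => rw [add_mul, map_add, hx, hy, add_zero]
    | smul a x _ hx => rw [smul_eq_mul, mul_right_comm, mul_comm, hx]
  have hy' (c) : pairing f g k l (y * c) = 0 := by
    clear hc
    induction hy using Submodule.span_induction generalizing c with
    | mem x hx =>
      obtain ⟨b, hb, rfl⟩ := hx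
      induction c with
      | zero => simp
      | add x y hx hy => rw [mul_add, map_add, hx, hy, add_zero]
      | tmul a b' =>
        simp [pairing_tmul, (hg.eq_zero_iff (b * b')).mpr (Q.mul_mem_right _ hb)]
    | zero => simp
    | add x y _ _ hx hy => rw [add_mul, map_add, hx, hy, add_zero]
    | smul a x _ hx => rw [smul_eq_mul, mul_right_comm, mul_comm, hx]
  rw [map_add, ← mul_one x, ← mul_one y, hx', hy', add_zero]

omit [Finite σ] [Finite τ] in
theorem map_pow_paramIdeal_pairing (hf : IsFreeEmbedding φ P f) (hg : IsFreeEmbedding ψ Q g)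
    (k : ι) (l : κ) (ϖ : O) (n : ℕ) {c : A ⊗[O] B}
    (hc : c ∈ (paramIdeal (σ ⊕ τ) ϖ ^ n).map (MvPolynomial.aeval (tensorParam φ ψ))) :
    pairing f g k l c ∈
      (paramIdeal (σ ⊕ τ) ϖ).map MvPolynomial.coeToMvPowerSeries.ringHom ^ n := by
  rw [← mul_one c]
  generalize (1 : A ⊗[O] B) = y
  induction hc using Submodule.span_induction generalizing y with
  | mem x hx =>
    obtain ⟨q, hq, rfl⟩ := hx
    rw [pairing_aeval_mul hf hg, ← Ideal.map_pow]
    exact Ideal.mul_mem_right _ _ (Ideal.mem_map_of_mem MvPolynomial.coeToMvPowerSeries.ringHom hq)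
  | zero => simp
  | add x z _ _ hx hz => rw [add_mul, map_add]; exact add_mem (hx y) (hz y)
  | smul a x _ hx => rw [smul_eq_mul, mul_comm a, mul_assoc]; exact hx _

theorem coeff_pairing [Finite ι] [Finite κ] (k : ι) (l : κ) (d d' : ℕ) (c : A ⊗[O] B)
    (e : {e : σ →₀ ℕ // e.degree < d}) (e' : {e : τ →₀ ℕ // e.degree < d'})
    [Finite {e : σ →₀ ℕ // e.degree < d}] [Finite {e : τ →₀ ℕ // e.degree < d'}] :
    coeff (e.1.embDomain Function.Embedding.inl + e'.1.embDomain Function.Embedding.inr)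
      (pairing f g k l c) = tensorCoord
        (LinearMap.pi fun x : ι × {e : σ →₀ ℕ // e.degree < d} =>
          coeff x.2.1 ∘ₗ LinearMap.proj x.1 ∘ₗ f)
        (LinearMap.pi fun x : κ × {e : τ →₀ ℕ // e.degree < d'} =>
          coeff x.2.1 ∘ₗ LinearMap.proj x.1 ∘ₗ g) c ((k, e), (l, e')) := by
  induction c with
  | zero => simp
  | add x y hx hy => simp only [map_add, hx, hy, Pi.add_apply]
  | tmul a b =>
    rw [tensorCoord_tmul, pairing_tmul, coeff_rename_inl_mul_rename_inr]
    rfl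

/-- The low-degree coefficients of f and g give O-linear maps α and β to finite free modules whose
kernels tensor into K + I^i. The coefficients of the pairings are the coordinates of α ⊗ β, so the
statement descends to Artin–Rees over O. -/
theorem exists_mem_of_pairing_mem [IsDedekindDomain O] [Finite ι] [Finite κ]
    (hf : IsFreeEmbedding φ P f) (hg : IsFreeEmbedding ψ Q g) {ϖ : O} {m : Ideal A} {n : Ideal B}
    (hm : ∀ i, φ (X i) ∈ m) (hn : ∀ i, ψ (X i) ∈ n) (hϖ : algebraMap O A ϖ ∈ m) (i : ℕ) :
    ∃ d, ∀ c, (∀ k l, pairing f g k l c ∈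
      (paramIdeal (σ ⊕ τ) ϖ).map MvPolynomial.coeToMvPowerSeries.ringHom ^ d) →
      c ∈ (P.map (Algebra.TensorProduct.includeLeft : A →ₐ[O] A ⊗[O] B) ⊔
        Q.map (Algebra.TensorProduct.includeRight : B →ₐ[O] A ⊗[O] B)) ⊔
        (m.map (Algebra.TensorProduct.includeLeft : A →ₐ[O] A ⊗[O] B) ⊔
        n.map (Algebra.TensorProduct.includeRight : B →ₐ[O] A ⊗[O] B)) ^ i := by
  obtain ⟨d₁, h₁⟩ := hf.exists_mem hm i
  obtain ⟨d₂, h₂⟩ := hg.exists_mem hn i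
  have : Finite {e : σ →₀ ℕ // e.degree < d₁} := Finsupp.finite_of_degree_lt d₁
  have : Finite {e : τ →₀ ℕ // e.degree < d₂} := Finsupp.finite_of_degree_lt d₂
  set α := LinearMap.pi fun x : ι × {e : σ →₀ ℕ // e.degree < d₁} =>
    (coeff x.2.1 ∘ₗ LinearMap.proj x.1 ∘ₗ f : A →ₗ[O] O) with hα
  set β := LinearMap.pi fun x : κ × {e : τ →₀ ℕ // e.degree < d₂} =>
    (coeff x.2.1 ∘ₗ LinearMap.proj x.1 ∘ₗ g : B →ₗ[O] O) with hβ
  set I := m.map (Algebra.TensorProduct.includeLeft : A →ₐ[O] A ⊗[O] B) ⊔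
    n.map (Algebra.TensorProduct.includeRight : B →ₐ[O] A ⊗[O] B) with hI
  set K := P.map (Algebra.TensorProduct.includeLeft : A →ₐ[O] A ⊗[O] B) ⊔
    Q.map (Algebra.TensorProduct.includeRight : B →ₐ[O] A ⊗[O] B) with hK
  have hα' (a : A) (b : B) (h : α a = 0) : a ⊗ₜ[O] b ∈ K ⊔ I ^ i := by
    have ha : a ∈ P ⊔ m ^ i := h₁ a fun k e he => congrFun h (k, ⟨e, he⟩)
    have hab : a ⊗ₜ[O] b = (Algebra.TensorProduct.includeLeft : A →ₐ[O] A ⊗[O] B) a * (1 ⊗ₜ b) := by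
      simp
    rw [hab]
    refine Ideal.mul_mem_right _ _ ?_
    have := Ideal.mem_map_of_mem (Algebra.TensorProduct.includeLeft : A →ₐ[O] A ⊗[O] B) ha
    rw [Ideal.map_sup, Ideal.map_pow] at this
    have h1 := Ideal.pow_right_mono
      (le_sup_left : m.map (Algebra.TensorProduct.includeLeft : A →ₐ[O] A ⊗[O] B) ≤ I) i
    exact (sup_le (le_sup_of_le_left le_sup_left) (le_sup_of_le_right h1) : _ ≤ K ⊔ I ^ i) this
  have hβ' (a : A) (b : B) (h : β b = 0) : a ⊗ₜ[O] b ∈ K ⊔ I ^ i := by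
    have hb : b ∈ Q ⊔ n ^ i := h₂ b fun k e he => congrFun h (k, ⟨e, he⟩)
    have hab : a ⊗ₜ[O] b = (a ⊗ₜ 1) *
        (Algebra.TensorProduct.includeRight : B →ₐ[O] A ⊗[O] B) b := by
      simp
    rw [hab]
    refine Ideal.mul_mem_left _ _ ?_
    have := Ideal.mem_map_of_mem (Algebra.TensorProduct.includeRight : B →ₐ[O] A ⊗[O] B) hb
    rw [Ideal.map_sup, Ideal.map_pow] at this
    have h1 := Ideal.pow_right_mono
      (le_sup_right : n.map (Algebra.TensorProduct.includeRight : B →ₐ[O] A ⊗[O] B) ≤ I) i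
    exact (sup_le (le_sup_of_le_left le_sup_right) (le_sup_of_le_right h1) : _ ≤ K ⊔ I ^ i) this
  have hϖ' : (Ideal.span {ϖ} ^ i • ⊤ : Submodule O (A ⊗[O] B)) ≤
      (K ⊔ I ^ i).restrictScalars O := by
    rw [Ideal.smul_top_eq_map, Ideal.map_pow, Ideal.map_span, Set.image_singleton]
    have h1 : Ideal.span {algebraMap O (A ⊗[O] B) ϖ} ≤ I := by
      rw [Ideal.span_singleton_le_iff_mem]
      exact Ideal.mem_sup_left
        (Ideal.mem_map_of_mem (Algebra.TensorProduct.includeLeft : A →ₐ[O] A ⊗[O] B) hϖ)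
    exact fun x hx => Ideal.mem_sup_right (Ideal.pow_right_mono h1 i hx)
  obtain ⟨d, hd⟩ := exists_mem_of_tensorCoord_mem α β ((K ⊔ I ^ i).restrictScalars O) hα' hβ'
    (Ideal.span {ϖ}) i hϖ'
  -- The exponents in play have degree below d₁ + d₂, leaving ϖ^d for each coefficient.
  refine ⟨d + (d₁ + d₂), fun c hc => hd c ?_⟩
  rintro ⟨⟨k, e⟩, ⟨l, e'⟩⟩
  rw [hα, hβ, ← coeff_pairing]
  refine coeff_mem_of_mem_pow_add ϖ (hc k l) ?_
  have := e.2
  have := e'.2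
  simp only [map_add, Finsupp.embDomain_eq_mapDomain, Finsupp.degree_mapDomain]
  omega

end MvPowerSeries

/-! ### Finiteness over power series rings and existence of free embeddings -/

namespace MvPowerSeries

variable {σ O : Type*} [CommRing O] [Finite σ]

omit [Finite σ] in
theorem algHom_coe_eq_aeval {E : Type*} [CommRing E] [Algebra O E] (φ : MvPowerSeries σ O →ₐ[O] E)
    (q : MvPolynomial σ O) : φ q = MvPolynomial.aeval (fun i => φ (X i)) q := by
  have : φ.comp (MvPolynomial.coeToMvPowerSeries.algHom O) =
      MvPolynomial.aeval (fun i => φ (X i)) := by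
    ext i
    simp
  rw [← this]
  simp

theorem finite_of_span_sup_eq_top {E : Type*} [CommRing E] [Algebra O E] (ϖ : O)
    [IsPrecomplete (Ideal.span {ϖ}) O] (I : Ideal E) [IsHausdorff I E]
    (φ : MvPowerSeries σ O →ₐ[O] E) (hX : ∀ i, φ (X i) ∈ I) (hϖ : algebraMap O E ϖ ∈ I)
    (W : Submodule O E) (hW : W.FG)
    (h : W ⊔ ((paramIdeal σ ϖ).map (MvPolynomial.aeval fun i => φ (X i))).restrictScalars O = ⊤) :
    φ.toRingHom.Finite := by
  let _ : Algebra (MvPowerSeries σ O) E := φ.toRingHom.toAlgebra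
  have : IsScalarTower O (MvPowerSeries σ O) E := IsScalarTower.of_algebraMap_eq fun r =>
    (φ.commutes r).symm
  set J := (paramIdeal σ ϖ).map
    (MvPolynomial.coeToMvPowerSeries.ringHom : _ →+* MvPowerSeries σ O) with hJ
  have hJmap : J.map (algebraMap (MvPowerSeries σ O) E) =
      (paramIdeal σ ϖ).map (MvPolynomial.aeval fun i => φ (X i)) := by
    rw [hJ, Ideal.map_map]
    have : (algebraMap (MvPowerSeries σ O) E).comp MvPolynomial.coeToMvPowerSeries.ringHom =
        (MvPolynomial.aeval (fun i => φ (X i)) : MvPolynomial σ O →ₐ[O] E).toRingHom :=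
      RingHom.ext fun q => algHom_coe_eq_aeval φ q
    rw [this]
    rfl
  have hJI : J.map (algebraMap (MvPowerSeries σ O) E) ≤ I := by
    rw [hJmap, paramIdeal, Ideal.map_sup, Ideal.map_span, Ideal.map_span, sup_le_iff,
      Ideal.span_le, Ideal.span_le]
    constructor
    · rintro _ ⟨_, rfl, rfl⟩
      simpa using hϖ
    · rintro _ ⟨_, ⟨i, rfl⟩, rfl⟩
      simpa using hX i
  have hH : IsHausdorff J E := by
    refine ⟨fun x hx => (inferInstance : IsHausdorff I E).haus x fun n => ?_⟩
    have := hx n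
    rw [SModEq.zero, Ideal.smul_top_eq_map, Ideal.map_pow] at this
    rw [SModEq.zero, smul_eq_mul, Ideal.mul_top]
    exact Ideal.pow_right_mono hJI n this
  have hP : IsPrecomplete J (MvPowerSeries σ O) := isPrecomplete_paramIdeal ϖ
  obtain ⟨s, rfl⟩ := hW
  refine Module.Finite.of_isPrecomplete_of_isHausdorff J (ι := s) (fun x => (x : E)) ?_
  rw [eq_top_iff]
  intro x _
  have hx : x ∈ Submodule.span O (s : Set E) ⊔
    ((paramIdeal σ ϖ).map (MvPolynomial.aeval fun i => φ (X i))).restrictScalars O := h ▸ trivial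
  obtain ⟨y, hy, z, hz, rfl⟩ := Submodule.mem_sup.mp hx
  refine Submodule.add_mem_sup ?_ ?_
  · rw [Subtype.range_coe_subtype]
    exact Submodule.span_subset_span O _ _ hy
  · rw [Ideal.smul_top_eq_map, hJmap]
    exact hz

variable {A : Type*} [CommRing A] [Algebra O A]

omit [Finite σ] in
theorem exists_isFreeEmbedding [IsDomain O] [IsNoetherianRing O] {φ : MvPowerSeries σ O →ₐ[O] A}
    (hφ : φ.toRingHom.Finite) (P : Ideal A) [P.IsPrime]
    (hinj : Function.Injective ((Ideal.Quotient.mk P).comp φ.toRingHom)) :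
    ∃ (n : ℕ) (f : A →ₗ[O] (Fin n → MvPowerSeries σ O)), IsFreeEmbedding φ P f := by
  let _ : Algebra (MvPowerSeries σ O) (A ⧸ P) :=
    ((Ideal.Quotient.mk P).comp φ.toRingHom).toAlgebra
  have : IsScalarTower O (MvPowerSeries σ O) (A ⧸ P) := IsScalarTower.of_algebraMap_eq fun r =>
    congrArg (Ideal.Quotient.mk P) (φ.commutes r).symm
  have : Module.Finite (MvPowerSeries σ O) (A ⧸ P) :=
    (RingHom.Finite.of_surjective _ Ideal.Quotient.mk_surjective).comp hφ
  have : IsDomain (MvPowerSeries σ O) := NoZeroDivisors.to_isDomain _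
  have : Module.IsTorsionFree (MvPowerSeries σ O) (A ⧸ P) :=
    Module.isTorsionFree_iff_algebraMap_injective.mpr hinj
  obtain ⟨n, f, hf⟩ := Module.exists_injective_to_pi (MvPowerSeries σ O) (A ⧸ P)
  refine ⟨n, (f.restrictScalars O) ∘ₗ (Ideal.Quotient.mkₐ O P).toLinearMap, fun s a => ?_,
    fun a => ?_⟩
  · exact (congrArg f (map_mul (Ideal.Quotient.mk P) _ _)).trans (f.map_smul s _)
  · rw [← Ideal.Quotient.eq_zero_iff_mem]
    exact map_eq_zero_iff f hf

end MvPowerSeries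

/-- A nonzero s in the kernel would make D integral over S/(s), whose dimension is strictly smaller.
-/
theorem RingHom.injective_of_isIntegral_of_ringKrullDim_eq {S D : Type*} [CommRing S] [IsDomain S]
    [CommRing D] [FiniteRingKrullDim S] (f : S →+* D) (hf : f.IsIntegral)
    (h : ringKrullDim D = ringKrullDim S) : Function.Injective f := by
  rw [injective_iff_map_eq_zero]
  intro s hs
  by_contra hne
  have h1 := ringKrullDim_quotient_succ_le_of_nonZeroDivisor (mem_nonZeroDivisors_of_ne_zero hne)
  let g : S ⧸ Ideal.span {s} →+* D := Ideal.Quotient.lift _ f fun x hx =>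
    (Ideal.span_singleton_le_iff_mem (RingHom.ker f)).mpr hs hx
  let _ : Algebra (S ⧸ Ideal.span {s}) D := g.toAlgebra
  have : Algebra.IsIntegral (S ⧸ Ideal.span {s}) D :=
    ⟨RingHom.IsIntegral.tower_top (Ideal.Quotient.mk _) g (by
      rwa [show g.comp (Ideal.Quotient.mk _) = f from RingHom.ext fun _ => rfl])⟩
  have h2 := ringKrullDim_le_of_isIntegral (S ⧸ Ideal.span {s}) D
  have h3 : ringKrullDim S + 1 ≤ ringKrullDim S :=
    (add_le_add_left (h ▸ h2) 1).trans h1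
  have hb := ringKrullDim_ne_bot (R := S)
  have ht := ringKrullDim_ne_top (R := S)
  generalize ringKrullDim S = d at h3 hb ht
  induction d with
  | bot => exact hb rfl
  | coe d =>
    induction d with
    | top => exact ht rfl
    | coe d =>
      have : d + 1 ≤ d := by exact_mod_cast h3
      omega

theorem RingHom.ringKrullDim_eq_of_isIntegral_of_injective {S D : Type*} [CommRing S]
    [CommRing D] (f : S →+* D) (hf : f.IsIntegral) (h : Function.Injective f) :
    ringKrullDim D = ringKrullDim S := by
  let _ := f.toAlgebra
  have : Algebra.IsIntegral S D := ⟨hf⟩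
  exact _root_.ringKrullDim_eq_of_isIntegral_of_injective h

/-! ### Parameters of a noetherian local ring -/

namespace IsLocalRing

variable {A : Type*} [CommRing A] [IsLocalRing A] [IsNoetherianRing A]

theorem exists_pow_le_span_insert {ϖ : A} (hϖ : ϖ ∈ maximalIdeal A) (hreg : ϖ ∈ nonZeroDivisors A) :
    ∃ (a : ℕ) (x : Fin a → A), (∀ i, x i ∈ maximalIdeal A) ∧ ringKrullDim A = a + 1 ∧
      ∃ N, maximalIdeal A ^ N ≤ Ideal.span {ϖ} ⊔ Ideal.span (Set.range x) := by
  have h1 := ringKrullDim_quotient_span_singleton_succ_eq_ringKrullDim_of_mem_nonZeroDivisors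
    hreg hϖ
  have : Nontrivial (A ⧸ Ideal.span {ϖ}) := Ideal.Quotient.nontrivial_iff.mpr fun h =>
    (mem_maximalIdeal ϖ).mp hϖ (Ideal.span_singleton_eq_top.mp h)
  have : IsLocalRing (A ⧸ Ideal.span {ϖ}) :=
    .of_surjective' (Ideal.Quotient.mk _) Ideal.Quotient.mk_surjective
  have : IsLocalHom (Ideal.Quotient.mk (Ideal.span {ϖ})) :=
    .of_surjective _ Ideal.Quotient.mk_surjective
  obtain ⟨s, hs, hcard⟩ := Ideal.exists_finset_card_eq_height_of_isNoetherianRing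
    (maximalIdeal (A ⧸ Ideal.span {ϖ}))
  have hmk := Ideal.Quotient.mk_surjective (I := Ideal.span {ϖ})
  choose y hy using hmk
  let x (i : Fin s.card) : A := y (s.equivFin.symm i).1
  have hx : Ideal.Quotient.mk (Ideal.span {ϖ}) '' Set.range x = s := by
    rw [← Set.range_comp]
    ext z
    constructor
    · rintro ⟨i, rfl⟩
      simp only [Function.comp_apply, x, hy]
      exact (s.equivFin.symm i).2
    · intro hz
      exact ⟨s.equivFin ⟨z, hz⟩, by simp [x, hy]⟩
  -- The maximal ideal is minimal over (s), hence the only prime containing s.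
  have hrad : maximalIdeal (A ⧸ Ideal.span {ϖ}) ≤ (Ideal.span (s : Set _)).radical := by
    rw [Ideal.radical_eq_sInf]
    refine le_sInf fun P ⟨hP, hPp⟩ => ?_
    exact hs.2 ⟨hPp, hP⟩ (le_maximalIdeal hPp.ne_top)
  obtain ⟨N, hN⟩ := Ideal.exists_pow_le_of_le_radical_of_fg hrad
    (IsNoetherian.noetherian _)
  refine ⟨s.card, x, fun i => ?_, ?_, N, ?_⟩
  · have : Ideal.Quotient.mk (Ideal.span {ϖ}) (x i) ∈ maximalIdeal (A ⧸ Ideal.span {ϖ}) := by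
      refine hs.1.2 (Ideal.subset_span ?_)
      rw [← hx]
      exact Set.mem_image_of_mem _ ⟨i, rfl⟩
    rw [mem_maximalIdeal] at this ⊢
    exact fun hu => this (hu.map _)
  · rw [← h1, ← maximalIdeal_height_eq_ringKrullDim, ← hcard]
    rfl
  · intro z hz
    have hz' : Ideal.Quotient.mk (Ideal.span {ϖ}) z ∈
        (Ideal.span (Set.range x)).map (Ideal.Quotient.mk (Ideal.span {ϖ})) := by
      rw [Ideal.map_span, hx]
      have hz1 := Ideal.mem_map_of_mem (Ideal.Quotient.mk (Ideal.span {ϖ})) hz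
      rw [Ideal.map_pow] at hz1
      refine hN (Ideal.pow_right_mono ?_ N hz1)
      rw [Ideal.map_le_iff_le_comap]
      exact fun w hw hu => hw (isUnit_of_map_unit (Ideal.Quotient.mk (Ideal.span {ϖ})) w hu)
    rw [← Ideal.mem_comap, Ideal.comap_map_of_surjective _ Ideal.Quotient.mk_surjective,
      ← RingHom.ker_eq_comap_bot, Ideal.mk_ker, sup_comm] at hz'
    exact hz'

/-- Each graded piece 𝔪^N / 𝔪^(N+1) is spanned over O by generators of 𝔪^N, because O surjects onto
the residue field. -/
theorem exists_fg_sup_pow_maximalIdeal_eq_top {O : Type*} [CommRing O] [Algebra O A]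
    (h : Function.Surjective (algebraMap O (ResidueField A))) (N : ℕ) :
    ∃ W : Submodule O A, W.FG ∧ W ⊔ (maximalIdeal A ^ N).restrictScalars O = ⊤ := by
  have hO (a : A) : ∃ r : O, a - algebraMap O A r ∈ maximalIdeal A := by
    obtain ⟨r, hr⟩ := h (residue A a)
    refine ⟨r, ?_⟩
    rw [← Ideal.Quotient.eq_zero_iff_mem, map_sub, sub_eq_zero]
    exact hr.symm
  induction N with
  | zero => exact ⟨⊥, Submodule.fg_bot, by simp⟩
  | succ N ih =>
    obtain ⟨W, hW, hWN⟩ := ih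
    obtain ⟨s, hs⟩ := IsNoetherian.noetherian (maximalIdeal A ^ N)
    refine ⟨W ⊔ Submodule.span O (s : Set A), hW.sup ⟨s, rfl⟩, ?_⟩
    rw [eq_top_iff, ← hWN, sup_assoc]
    refine sup_le_sup_left (fun x hx => ?_) W
    have hx' : x ∈ Submodule.span A (s : Set A) := by rw [hs]; exact hx
    clear hx
    induction hx' using Submodule.span_induction with
    | mem x hx => exact Submodule.mem_sup_left (Submodule.subset_span hx)
    | zero => exact zero_mem _
    | add x y _ _ hx hy => exact add_mem hx hy
    | smul a x hx hx' =>
      obtain ⟨r, hr⟩ := hO a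
      rw [← sub_add_cancel a (algebraMap O A r), add_smul, algebraMap_smul]
      refine add_mem (Submodule.mem_sup_right ?_) (Submodule.smul_mem _ _ hx')
      rw [Submodule.restrictScalars_mem, smul_eq_mul, mul_comm, pow_succ]
      exact Ideal.mul_mem_mul (hs ▸ hx) hr

end IsLocalRing

/-! ### The ring of integers: complete, local, of dimension one -/

theorem IsPrecomplete.of_surjective {R M N : Type*} [CommRing R] [AddCommGroup M] [Module R M]
    [AddCommGroup N] [Module R N] (I : Ideal R) [IsPrecomplete I M] (f : M →ₗ[R] N)
    (hf : Function.Surjective f) : IsPrecomplete I N := by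
  rw [← AdicCompletion.of_surjective_iff]
  intro y
  obtain ⟨x, rfl⟩ := AdicCompletion.map_surjective I hf y
  obtain ⟨x, rfl⟩ := AdicCompletion.of_surjective I M x
  exact ⟨f x, (AdicCompletion.map_of I f x).symm⟩

/-- In the Artinian quotient the powers of x stabilise and yield an idempotent, which Hensel's lemma
lifts to the domain O. There it is 0 or 1, so x is either nilpotent or a unit mod ϖ. -/
theorem IsLocalRing.of_isAdicComplete_span_singleton {O : Type*} [CommRing O] [IsDomain O]
    (ϖ : O) [IsAdicComplete (Ideal.span {ϖ}) O] [IsArtinianRing (O ⧸ Ideal.span {ϖ})] :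
    IsLocalRing O := by
  have hjac := IsAdicComplete.le_jacobson_bot (Ideal.span {ϖ})
  refine .of_isUnit_or_isUnit_one_sub_self fun x => ?_
  obtain ⟨n, y, hy⟩ := IsArtinian.exists_pow_succ_smul_dvd
    (M := O ⧸ Ideal.span {ϖ}) (Ideal.Quotient.mk (Ideal.span {ϖ}) x) 1
  obtain ⟨y, rfl⟩ := Ideal.Quotient.mk_surjective y
  simp only [smul_eq_mul, mul_one] at hy
  have hpow (k : ℕ) : Ideal.Quotient.mk (Ideal.span {ϖ}) (x ^ (n + k) * y ^ k) =
      Ideal.Quotient.mk (Ideal.span {ϖ}) x ^ n := by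
    induction k with
    | zero => simp
    | succ k ih =>
      rw [← ih]
      simp only [map_mul, map_pow]
      calc _ = (Ideal.Quotient.mk (Ideal.span {ϖ}) x ^ (n + 1) * Ideal.Quotient.mk _ y) *
              (Ideal.Quotient.mk _ x ^ k * Ideal.Quotient.mk _ y ^ k) := by ring
        _ = _ := by rw [hy]; ring
  have hn := hpow n
  have he : (x ^ n * y ^ n) ^ 2 - x ^ n * y ^ n ∈ Ideal.span {ϖ} := by
    rw [← Ideal.Quotient.mk_eq_mk_iff_sub_mem]
    calc _ = Ideal.Quotient.mk (Ideal.span {ϖ}) (x ^ (n + n) * y ^ n) *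
            Ideal.Quotient.mk _ y ^ n := by simp only [map_mul, map_pow]; ring
      _ = _ := by rw [hn]; simp only [map_mul, map_pow]
  obtain ⟨e, he', hee⟩ := HenselianRing.is_henselian (I := Ideal.span {ϖ})
    (Polynomial.X ^ 2 - Polynomial.X : Polynomial O)
    (by monicity!) (x ^ n * y ^ n) (by simpa using he) (by
      -- At an idempotent e the derivative 2e − 1 is its own inverse: (2e − 1)² − 1 = 4(e² − e).
      refine IsUnit.of_mul_eq_one (Ideal.Quotient.mk _ (2 * (x ^ n * y ^ n) - 1)) ?_
      rw [← map_mul, ← map_one (Ideal.Quotient.mk _), Ideal.Quotient.mk_eq_mk_iff_sub_mem]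
      simp only [Polynomial.derivative_sub, Polynomial.derivative_X_pow, Polynomial.derivative_X,
        Polynomial.eval_sub, Polynomial.eval_mul, Polynomial.eval_one, Polynomial.eval_pow,
        Polynomial.eval_X, Polynomial.eval_C]
      have := Ideal.mul_mem_left _ 4 he
      convert this using 1
      push_cast
      ring)
  have he2 : e * (e - 1) = 0 := by
    have : e ^ 2 - e = 0 := by simpa using he'
    rw [← this]; ring
  rcases mul_eq_zero.mp he2 with h | h
  · right
    have hx : x ^ n ∈ Ideal.span {ϖ} := by
      rw [← Ideal.Quotient.eq_zero_iff_mem, map_pow, ← hn, pow_add, mul_assoc, map_mul]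
      rw [h, zero_sub, neg_mem_iff] at hee
      rw [Ideal.Quotient.eq_zero_iff_mem.mpr hee, mul_zero]
    have h1 := Ideal.mem_jacobson_bot.mp (hjac hx) (-1)
    refine isUnit_of_dvd_unit (sub_dvd_pow_sub_pow 1 x n) ?_
    rwa [one_pow, sub_eq_neg_add, ← mul_neg_one]
  · left
    have hx : x ^ (n + 1) * y ^ (n + 1) - 1 ∈ Ideal.span {ϖ} := by
      rw [← Ideal.Quotient.mk_eq_mk_iff_sub_mem, pow_succ y, ← mul_assoc]
      rw [sub_eq_zero.mp h, ← Ideal.Quotient.mk_eq_mk_iff_sub_mem] at hee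
      rw [hee]
      calc _ = Ideal.Quotient.mk (Ideal.span {ϖ}) (x ^ (n + 1) * y ^ 1) *
              Ideal.Quotient.mk _ y ^ n := by simp only [map_mul, map_pow]; ring
        _ = _ := by rw [hpow 1]; simp only [map_mul, map_pow]
    have h1 := Ideal.mem_jacobson_bot.mp (hjac hx) 1
    refine isUnit_of_dvd_unit ?_ h1
    rw [mul_one, sub_add_cancel, pow_succ', mul_assoc]
    exact dvd_mul_right _ _

namespace PadicIntegers

variable (p : ℕ) [Fact p.Prime] (L : Type*) [Field L] [Algebra ℚ_[p] L]
    [FiniteDimensional ℚ_[p] L] [Algebra ℤ_[p] L] [IsScalarTower ℤ_[p] ℚ_[p] L]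

include p L

theorem moduleFinite : Module.Finite ℤ_[p] (PadicIntegers p L) :=
  IsIntegralClosure.finite ℤ_[p] ℚ_[p] L _

theorem isDedekindDomain : IsDedekindDomain (PadicIntegers p L) :=
  integralClosure.isDedekindDomain ℤ_[p] ℚ_[p] L

omit [FiniteDimensional ℚ_[p] L] in
theorem injective_algebraMap : Function.Injective (algebraMap ℤ_[p] (PadicIntegers p L)) := by
  have h : Function.Injective (algebraMap ℤ_[p] L) := by
    rw [IsScalarTower.algebraMap_eq ℤ_[p] ℚ_[p] L]
    exact (algebraMap ℚ_[p] L).injective.comp (IsFractionRing.injective ℤ_[p] ℚ_[p])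
  rw [IsScalarTower.algebraMap_eq ℤ_[p] (PadicIntegers p L) L] at h
  exact Function.Injective.of_comp (f := algebraMap (PadicIntegers p L) L) h

omit [FiniteDimensional ℚ_[p] L] in
theorem natCast_ne_zero : (p : PadicIntegers p L) ≠ 0 := by
  intro h
  have h1 : algebraMap ℤ_[p] (PadicIntegers p L) p = algebraMap ℤ_[p] (PadicIntegers p L) 0 := by
    simpa using h
  exact (Nat.cast_ne_zero.mpr (Fact.out : p.Prime).ne_zero) (injective_algebraMap p L h1)

theorem ringKrullDim_eq_one : ringKrullDim (PadicIntegers p L) = 1 := by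
  have := moduleFinite p L
  rw [ringKrullDim_eq_of_isIntegral_of_injective (injective_algebraMap p L)]
  exact IsPrincipalIdealRing.ringKrullDim_eq_one _ (IsDiscreteValuationRing.not_isField _)

theorem isAdicComplete : IsAdicComplete (Ideal.span {(p : PadicIntegers p L)})
    (PadicIntegers p L) := by
  have := moduleFinite p L
  have := isDedekindDomain p L
  have hmap : (IsLocalRing.maximalIdeal ℤ_[p]).map (algebraMap ℤ_[p] (PadicIntegers p L)) =
      Ideal.span {(p : PadicIntegers p L)} := by
    rw [PadicInt.maximalIdeal_eq_span_p, Ideal.map_span, Set.image_singleton, map_natCast]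
  obtain ⟨n, f, hf⟩ := Module.Finite.exists_fin' ℤ_[p] (PadicIntegers p L)
  have := IsPrecomplete.pi_self (ι := Fin n) (IsLocalRing.maximalIdeal ℤ_[p])
  have h1 := IsPrecomplete.of_surjective (IsLocalRing.maximalIdeal ℤ_[p]) f hf
  have h2 : IsHausdorff (IsLocalRing.maximalIdeal ℤ_[p]) (PadicIntegers p L) := inferInstance
  rw [← hmap]
  exact { IsHausdorff.map_algebraMap_iff.mpr h2, IsPrecomplete.map_algebraMap_iff.mpr h1 with }

theorem isArtinianRing_quotient :
    IsArtinianRing (PadicIntegers p L ⧸ Ideal.span {(p : PadicIntegers p L)}) := by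
  have := isDedekindDomain p L
  rw [isArtinianRing_iff_krullDimLE_zero, Ring.KrullDimLE, Order.krullDimLE_iff,
    ← ENat.WithBot.add_le_add_one_right_iff, Nat.cast_zero, zero_add]
  exact (ringKrullDim_quotient_succ_le_of_nonZeroDivisor
    (mem_nonZeroDivisors_of_ne_zero (natCast_ne_zero p L))).trans (ringKrullDim_eq_one p L).le

theorem isLocalRing : IsLocalRing (PadicIntegers p L) := by
  have := isDedekindDomain p L
  have := isAdicComplete p L
  have := isArtinianRing_quotient p L
  exact .of_isAdicComplete_span_singleton (p : PadicIntegers p L)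

end PadicIntegers

/-! ### Torsion-freeness by approximation -/

theorem FiniteRingKrullDim.of_eq_natCast {R : Type*} [CommRing R] {n : ℕ}
    (h : ringKrullDim R = n) : FiniteRingKrullDim R := by
  rw [finiteRingKrullDim_iff_ne_bot_and_top, h]
  exact ⟨WithBot.coe_ne_bot (a := (n : ℕ∞)), WithBot.coe_injective.ne (ENat.natCast_ne_top n)⟩

theorem Ideal.mem_of_forall_mem_sup_pow {R : Type*} [CommRing R] [IsNoetherianRing R]
    {I : Ideal R} (hI : I ≤ (⊥ : Ideal R).jacobson) (K : Ideal R) {r : R}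
    (h : ∀ i, r ∈ K ⊔ I ^ i) : r ∈ K := by
  have := IsHausdorff.of_le_jacobson (M := R ⧸ K) I hI
  rw [← Ideal.Quotient.eq_zero_iff_mem]
  refine this.haus _ fun i => ?_
  rw [SModEq.zero, Ideal.smul_top_eq_map, Submodule.restrictScalars_mem,
    Ideal.Quotient.algebraMap_eq]
  obtain ⟨x, hx, y, hy, rfl⟩ := Submodule.mem_sup.mp (h i)
  rw [map_add, Ideal.Quotient.eq_zero_iff_mem.mpr hx, zero_add]
  exact Ideal.mem_map_of_mem _ hy

theorem Ideal.exists_mem_pow_of_mul_mem_pow {U : Type*} [CommRing U] [IsDomain U]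
    [IsNoetherianRing U] (J : Ideal U) {u : U} (hu : u ≠ 0) (M : ℕ) :
    ∃ d, ∀ v, u * v ∈ J ^ d → v ∈ J ^ M := by
  obtain ⟨d, hd⟩ := Ideal.exists_pow_smul_top_inf_le J (Ideal.span {u}) M
  refine ⟨d, fun v hv => ?_⟩
  have h : u * v ∈ J ^ M • Ideal.span {u} :=
    hd ⟨by simpa using hv, Ideal.mem_span_singleton.mpr (dvd_mul_right u v)⟩
  rw [smul_eq_mul, Ideal.mem_mul_span_singleton] at h
  obtain ⟨w, hw, hwu⟩ := h
  rw [mul_comm w] at hwu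
  rwa [← mul_left_cancel₀ hu hwu]

namespace MvPowerSeries

variable {σ τ O A B R : Type*} [CommRing O] [Finite σ] [Finite τ] [CommRing A] [CommRing B]
  [Algebra O A] [Algebra O B] [CommRing R] [Algebra O R]

omit [Finite σ] in
theorem map_aeval_paramIdeal (ϖ : O) {E : Type*} [CommRing E] [Algebra O E] (z : σ → E) :
    (paramIdeal σ ϖ).map (MvPolynomial.aeval z) =
      Ideal.span {algebraMap O E ϖ} ⊔ Ideal.span (Set.range z) := by
  rw [paramIdeal, Ideal.map_sup, Ideal.map_span, Ideal.map_span, Set.image_singleton,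
    ← Set.range_comp]
  congr 3
  · simp
  · ext i
    simp

/-- Replace u, r and ev u * r by a polynomial q, some c in A ⊗ B and some y in K. The pairings kill
y and are linear over polynomials, so u times each pairing of c is small. Artin–Rees for (u) makes
the pairings of c themselves small. -/
theorem mem_sup_of_mul_mem [IsDedekindDomain O] {φ : MvPowerSeries σ O →ₐ[O] A}
    {ψ : MvPowerSeries τ O →ₐ[O] B} {P : Ideal A} {Q : Ideal B} {ι κ : Type*} [Finite ι] [Finite κ]
    {f : A →ₗ[O] (ι → MvPowerSeries σ O)} {g : B →ₗ[O] (κ → MvPowerSeries τ O)}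
    (hf : IsFreeEmbedding φ P f) (hg : IsFreeEmbedding ψ Q g) {ϖ : O} {m : Ideal A} {n : Ideal B}
    (hm : ∀ i, φ (X i) ∈ m) (hn : ∀ i, ψ (X i) ∈ n) (hϖ : algebraMap O A ϖ ∈ m)
    {I K : Ideal (A ⊗[O] B)}
    (hI : I = m.map (Algebra.TensorProduct.includeLeft : A →ₐ[O] A ⊗[O] B) ⊔
      n.map (Algebra.TensorProduct.includeRight : B →ₐ[O] A ⊗[O] B))
    (hK : K = P.map (Algebra.TensorProduct.includeLeft : A →ₐ[O] A ⊗[O] B) ⊔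
      Q.map (Algebra.TensorProduct.includeRight : B →ₐ[O] A ⊗[O] B))
    {N : ℕ} (hN : I ^ N ≤ (paramIdeal (σ ⊕ τ) ϖ).map (MvPolynomial.aeval (tensorParam φ ψ)))
    (h : A ⊗[O] B →ₐ[O] R) (happrox : ∀ k r, ∃ c, r - h c ∈ (I.map h) ^ k)
    (hcomap : ∀ k c, h c ∈ (I.map h) ^ k → c ∈ I ^ k)
    {ev : MvPowerSeries (σ ⊕ τ) O →ₐ[O] R}
    (hev : ∀ k u, ev u - h (MvPolynomial.aeval (tensorParam φ ψ) (truncTotal k u)) ∈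
      (I.map h) ^ k) {u : MvPowerSeries (σ ⊕ τ) O} (hu : u ≠ 0) {r : R}
    (hr : ev u * r ∈ K.map h) (i : ℕ) : r ∈ K.map h ⊔ (I.map h) ^ i := by
  have : IsDomain (MvPowerSeries (σ ⊕ τ) O) := NoZeroDivisors.to_isDomain _
  obtain ⟨M, hM⟩ := exists_mem_of_pairing_mem hf hg hm hn hϖ i
  rw [← hI, ← hK] at hM
  set J := (paramIdeal (σ ⊕ τ) ϖ).map
    (MvPolynomial.coeToMvPowerSeries.ringHom : _ →+* MvPowerSeries (σ ⊕ τ) O) with hJ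
  obtain ⟨d, hd⟩ := Ideal.exists_mem_pow_of_mul_mem_pow J hu M
  have hKmem (k : ℕ) {x : R} (hx : x ∈ K.map h) : ∃ y ∈ K, x - h y ∈ (I.map h) ^ k := by
    induction hx using Submodule.span_induction with
    | mem x hx =>
      obtain ⟨y, hy, rfl⟩ := hx
      exact ⟨y, hy, by simp⟩
    | zero => exact ⟨0, zero_mem _, by simp⟩
    | add x y _ _ hx hy =>
      obtain ⟨x', hx', hxx⟩ := hx
      obtain ⟨y', hy', hyy⟩ := hy
      refine ⟨x' + y', add_mem hx' hy', ?_⟩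
      convert add_mem hxx hyy using 1
      rw [map_add]; ring
    | smul a x _ hx =>
      obtain ⟨x', hx', hxx⟩ := hx
      obtain ⟨a', ha⟩ := happrox k a
      refine ⟨a' * x', Ideal.mul_mem_left _ _ hx', ?_⟩
      convert add_mem (Ideal.mul_mem_left _ a hxx) (Ideal.mul_mem_right (h x') _ ha) using 1
      rw [map_mul, smul_eq_mul]; ring
  -- The summands serve, in order, the error r − h c, the inclusion of I^(N * d) in the d-th power
  -- of the parameter ideal, and the truncation error of u.
  let k := i + N * d + d
  obtain ⟨c, hc⟩ := happrox k r
  obtain ⟨y, hy, hxy⟩ := hKmem k hr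
  set q := truncTotal k u with hq
  have h1 : h (MvPolynomial.aeval (tensorParam φ ψ) q * c - y) ∈ (I.map h) ^ k := by
    convert sub_mem hxy (add_mem (Ideal.mul_mem_right r _ (hev k u))
      (Ideal.mul_mem_left _ (h (MvPolynomial.aeval (tensorParam φ ψ) q)) hc)) using 1
    rw [map_sub, map_mul]; ring
  have h2 := hcomap k _ h1
  have hcK : c ∈ K ⊔ I ^ i := by
    refine hM c fun a b => hd _ ?_
    have h0 : pairing f g a b y = 0 := pairing_eq_zero hf hg a b (hK ▸ hy)
    have h3 : pairing f g a b (MvPolynomial.aeval (tensorParam φ ψ) q * c) ∈ J ^ d := by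
      rw [← sub_add_cancel (MvPolynomial.aeval (tensorParam φ ψ) q * c) y, map_add,
        h0, add_zero]
      refine map_pow_paramIdeal_pairing hf hg a b ϖ d ?_
      rw [Ideal.map_pow]
      refine Ideal.pow_right_mono hN d ?_
      rw [← pow_mul]
      exact Ideal.pow_le_pow_right (by omega) h2
    rw [pairing_aeval_mul hf hg] at h3
    have h4 : u - (q : MvPowerSeries (σ ⊕ τ) O) ∈ J ^ d := by
      rw [hJ, map_paramIdeal]
      refine Ideal.pow_right_mono le_sup_right d ?_
      rw [mem_span_X_pow_iff]
      intro e he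
      rw [map_sub, MvPolynomial.coeff_coe, hq, coeff_truncTotal _ (by omega), sub_self]
    rw [← sub_add_cancel u (q : MvPowerSeries (σ ⊕ τ) O), add_mul]
    exact add_mem (Ideal.mul_mem_right _ _ h4) h3
  rw [← sub_add_cancel r (h c)]
  refine add_mem (Ideal.mem_sup_right (Ideal.pow_le_pow_right (by omega) hc)) ?_
  have := Ideal.mem_map_of_mem h hcK
  rwa [Ideal.map_sup, Ideal.map_pow] at this

end MvPowerSeries

/-! ### Finite power series subrings and minimal primes of full dimension -/

open MvPowerSeries in
theorem IsTorsionFreeCompleteLocalAlgebra.exists_finite_mvPowerSeries {O A : Type*} [CommRing O]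
    [IsDomain O] [IsLocalRing O] [IsNoetherianRing O] [CommRing A] [IsLocalRing A] [Algebra O A]
    (hA : IsTorsionFreeCompleteLocalAlgebra O A)
    {ϖ : O} (hϖ : ϖ ≠ 0) [IsPrecomplete (Ideal.span {ϖ}) O]
    (hϖA : algebraMap O A ϖ ∈ IsLocalRing.maximalIdeal A) :
    ∃ (a : ℕ) (φ : MvPowerSeries (Fin a) O →ₐ[O] A) (N : ℕ),
      (∀ i, φ (X i) ∈ IsLocalRing.maximalIdeal A) ∧ φ.toRingHom.Finite ∧
      ringKrullDim A = a + 1 ∧ IsLocalRing.maximalIdeal A ^ N ≤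
        (paramIdeal (Fin a) ϖ).map (MvPolynomial.aeval fun i => φ (X i)) := by
  have := hA.noetherian
  have := hA.complete
  have := hA.torsionFree
  have hreg : algebraMap O A ϖ ∈ nonZeroDivisors A := by
    rw [mem_nonZeroDivisors_iff_right]
    intro x hx
    rw [mul_comm, ← Algebra.smul_def] at hx
    exact (smul_eq_zero_iff_right hϖ).mp hx
  obtain ⟨a, x, hx, hdim, N, hN⟩ := IsLocalRing.exists_pow_le_span_insert hϖA hreg
  obtain ⟨φ, hφ, -⟩ := exists_algHom_aeval_truncTotal (O := O) (IsLocalRing.maximalIdeal A) x hx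
  have hφx : (fun i => φ (X i)) = x := funext hφ
  have hN' : IsLocalRing.maximalIdeal A ^ N ≤
      (paramIdeal (Fin a) ϖ).map (MvPolynomial.aeval fun i => φ (X i)) := by
    rwa [map_aeval_paramIdeal, hφx]
  obtain ⟨W, hW, hWN⟩ :=
    IsLocalRing.exists_fg_sup_pow_maximalIdeal_eq_top hA.residueField N
  refine ⟨a, φ, N, fun i => (hφ i).symm ▸ hx i, ?_, hdim, hN'⟩
  refine finite_of_span_sup_eq_top ϖ (IsLocalRing.maximalIdeal A) φ
    (fun i => (hφ i).symm ▸ hx i) hϖA W hW ?_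
  rw [eq_top_iff, ← hWN]
  exact sup_le_sup_left (fun x hx => hN' hx) W

open MvPowerSeries in
theorem exists_isFreeEmbedding_of_ringKrullDim_eq {O A : Type*} [CommRing O] [IsDomain O]
    [IsNoetherianRing O] [CommRing A] [Algebra O A] (hO : ringKrullDim O = 1) {a : ℕ}
    {φ : MvPowerSeries (Fin a) O →ₐ[O] A} (hφ : φ.toRingHom.Finite) (P : Ideal A) [P.IsPrime]
    (hP : ringKrullDim (A ⧸ P) = a + 1) :
    ∃ (n : ℕ) (f : A →ₗ[O] (Fin n → MvPowerSeries (Fin a) O)), IsFreeEmbedding φ P f := by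
  have : IsDomain (MvPowerSeries (Fin a) O) := NoZeroDivisors.to_isDomain _
  have hdim : ringKrullDim (MvPowerSeries (Fin a) O) = a + 1 := by
    rw [ringKrullDim_eq_add_card, hO, Nat.card_fin, add_comm]
  have : FiniteRingKrullDim (MvPowerSeries (Fin a) O) :=
    .of_eq_natCast (n := a + 1) (by rw [hdim, Nat.cast_add, Nat.cast_one])
  refine exists_isFreeEmbedding hφ P (RingHom.injective_of_isIntegral_of_ringKrullDim_eq _ ?_
    (hP.trans hdim.symm))
  exact ((RingHom.Finite.of_surjective _ Ideal.Quotient.mk_surjective).comp hφ).to_isIntegral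

/-! ### Completion along a finitely generated ideal -/

namespace AdicCompletion

variable {C : Type*} [CommRing C] {I : Ideal C}

theorem mem_map_pow_iff_evalₐ_eq_zero (hI : I.FG) (k : ℕ) (x : AdicCompletion I C) :
    x ∈ (I.map (algebraMap C (AdicCompletion I C))) ^ k ↔ evalₐ I k x = 0 := by
  have h := SetLike.ext_iff.mp (pow_smul_top_eq_ker_eval (M := C) (n := k) hI) x
  rw [LinearMap.mem_ker] at h
  rw [← Ideal.map_pow]
  have h1 : x ∈ (I ^ k).map (algebraMap C (AdicCompletion I C)) ↔
      x ∈ (I ^ k • ⊤ : Submodule C (AdicCompletion I C)) := by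
    rw [Ideal.smul_top_eq_map]
    rfl
  rw [h1, h]
  have hle : I ^ k • ⊤ ≤ I ^ k := by simp
  have hle' : I ^ k ≤ I ^ k • ⊤ := by simp
  refine ⟨fun h => ?_, fun h => ?_⟩
  · rw [← factor_eval_eq_evalₐ I x hle, h]
    exact _root_.map_zero (Submodule.factor hle)
  · rw [← factor_evalₐ_eq_eval I x hle', h]
    exact _root_.map_zero (Ideal.Quotient.factor hle')

theorem exists_sub_algebraMap_mem (hI : I.FG) (k : ℕ) (x : AdicCompletion I C) :
    ∃ c, x - algebraMap C (AdicCompletion I C) c ∈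
      (I.map (algebraMap C (AdicCompletion I C))) ^ k := by
  obtain ⟨c, hc⟩ := Ideal.Quotient.mk_surjective (evalₐ I k x)
  refine ⟨c, (mem_map_pow_iff_evalₐ_eq_zero hI k _).mpr ?_⟩
  rw [map_sub, sub_eq_zero, ← hc]
  exact (evalₐ_of I k c).symm

theorem mem_pow_of_algebraMap_mem (hI : I.FG) (k : ℕ) (c : C)
    (h : algebraMap C (AdicCompletion I C) c ∈
      (I.map (algebraMap C (AdicCompletion I C))) ^ k) : c ∈ I ^ k := by
  rw [mem_map_pow_iff_evalₐ_eq_zero hI] at h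
  exact Ideal.Quotient.eq_zero_iff_mem.mp ((evalₐ_of I k c).symm.trans h)

theorem isAdicComplete_map (hI : I.FG) :
    IsAdicComplete (I.map (algebraMap C (AdicCompletion I C))) (AdicCompletion I C) :=
  (IsAdicComplete.map_algebraMap_iff (I := I) (M := AdicCompletion I C)).mpr (isAdicComplete hI)

end AdicCompletion

/-! ### The ideal of the tensor product and finiteness of the completion -/

namespace IsTorsionFreeCompleteLocalAlgebra

open IsLocalRing

variable {O A B : Type*} [CommRing O] [IsLocalRing O] [CommRing A] [IsLocalRing A] [CommRing B]
  [IsLocalRing B] [Algebra O A] [Algebra O B]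

theorem ker_algebraMap_residueField (hA : IsTorsionFreeCompleteLocalAlgebra O A) :
    RingHom.ker (algebraMap O (ResidueField A)) = maximalIdeal O :=
  eq_maximalIdeal (RingHom.ker_isMaximal_of_surjective _ hA.residueField)

theorem algebraMap_mem_maximalIdeal (hA : IsTorsionFreeCompleteLocalAlgebra O A) {x : O}
    (hx : x ∈ maximalIdeal O) : algebraMap O A x ∈ maximalIdeal A := by
  rw [← hA.ker_algebraMap_residueField, RingHom.mem_ker,
    IsScalarTower.algebraMap_apply O A (ResidueField A)] at hx
  exact Ideal.Quotient.eq_zero_iff_mem.mp hx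

/-- Both residue fields are the residue field of O, so A ⊗ B maps to the residue field of A and
kills the ideal. This keeps the completion nonzero. -/
theorem tensorMaximalIdeal_ne_top (hA : IsTorsionFreeCompleteLocalAlgebra O A)
    (hB : IsTorsionFreeCompleteLocalAlgebra O B) : tensorMaximalIdeal O A B ≠ ⊤ := by
  let g : ResidueField B →+* ResidueField A := RingHom.liftOfSurjective _ hB.residueField
    ⟨algebraMap O (ResidueField A), (hB.ker_algebraMap_residueField.trans
      hA.ker_algebraMap_residueField.symm).le⟩
  have hg (x : O) : g (algebraMap O (ResidueField B) x) = algebraMap O (ResidueField A) x :=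
    RingHom.liftOfRightInverse_comp_apply _ _ _ _ x
  let g' : ResidueField B →ₐ[O] ResidueField A := { g with commutes' := hg }
  let F : A ⊗[O] B →ₐ[O] ResidueField A := Algebra.TensorProduct.productMap
    (IsScalarTower.toAlgHom O A (ResidueField A))
    (g'.comp (IsScalarTower.toAlgHom O B (ResidueField B)))
  have hle : tensorMaximalIdeal O A B ≤ RingHom.ker F := by
    refine sup_le (Ideal.map_le_iff_le_comap.mpr fun x hx => ?_)
      (Ideal.map_le_iff_le_comap.mpr fun x hx => ?_)
    · simpa [F] using hx
    · simpa [F] using hx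
  exact fun h => RingHom.ker_ne_top F.toRingHom (top_le_iff.mp (h ▸ hle))

end IsTorsionFreeCompleteLocalAlgebra

namespace MvPowerSeries

variable {σ τ O A B : Type*} [CommRing O] [CommRing A] [CommRing B] [Algebra O A] [Algebra O B]
  {φ : MvPowerSeries σ O →ₐ[O] A} {ψ : MvPowerSeries τ O →ₐ[O] B}

theorem map_includeLeft_paramIdeal_le (ϖ : O) :
    ((paramIdeal σ ϖ).map (MvPolynomial.aeval fun i => φ (X i))).map
      (Algebra.TensorProduct.includeLeft : A →ₐ[O] A ⊗[O] B) ≤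
      (paramIdeal (σ ⊕ τ) ϖ).map (MvPolynomial.aeval (tensorParam φ ψ)) := by
  rw [map_aeval_paramIdeal, map_aeval_paramIdeal, Ideal.map_sup, Ideal.map_span, Ideal.map_span,
    Set.image_singleton, AlgHom.commutes]
  refine sup_le_sup_left (Ideal.span_mono ?_) _
  rintro _ ⟨_, ⟨i, rfl⟩, rfl⟩
  exact ⟨Sum.inl i, rfl⟩

theorem map_includeRight_paramIdeal_le (ϖ : O) :
    ((paramIdeal τ ϖ).map (MvPolynomial.aeval fun i => ψ (X i))).map
      (Algebra.TensorProduct.includeRight : B →ₐ[O] A ⊗[O] B) ≤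
      (paramIdeal (σ ⊕ τ) ϖ).map (MvPolynomial.aeval (tensorParam φ ψ)) := by
  rw [map_aeval_paramIdeal, map_aeval_paramIdeal, Ideal.map_sup, Ideal.map_span, Ideal.map_span,
    Set.image_singleton, AlgHom.commutes]
  refine sup_le_sup_left (Ideal.span_mono ?_) _
  rintro _ ⟨_, ⟨i, rfl⟩, rfl⟩
  exact ⟨Sum.inr i, rfl⟩

variable [IsLocalRing A] [IsLocalRing B] {ϖ : O} {N₁ N₂ : ℕ}

theorem tensorMaximalIdeal_pow_le
    (hA : IsLocalRing.maximalIdeal A ^ N₁ ≤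
      (paramIdeal σ ϖ).map (MvPolynomial.aeval fun i => φ (X i)))
    (hB : IsLocalRing.maximalIdeal B ^ N₂ ≤
      (paramIdeal τ ϖ).map (MvPolynomial.aeval fun i => ψ (X i))) :
    tensorMaximalIdeal O A B ^ (N₁ + N₂) ≤
      (paramIdeal (σ ⊕ τ) ϖ).map (MvPolynomial.aeval (tensorParam φ ψ)) := by
  refine Ideal.sup_pow_add_le_pow_sup_pow.trans (sup_le ?_ ?_)
  · rw [← Ideal.map_pow]
    exact (Ideal.map_mono hA).trans (map_includeLeft_paramIdeal_le ϖ)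
  · rw [← Ideal.map_pow]
    exact (Ideal.map_mono hB).trans (map_includeRight_paramIdeal_le ϖ)

theorem exists_fg_sup_map_paramIdeal_eq_top [IsNoetherianRing A] [IsNoetherianRing B]
    (hA' : Function.Surjective (algebraMap O (IsLocalRing.ResidueField A)))
    (hB' : Function.Surjective (algebraMap O (IsLocalRing.ResidueField B)))
    (hA : IsLocalRing.maximalIdeal A ^ N₁ ≤
      (paramIdeal σ ϖ).map (MvPolynomial.aeval fun i => φ (X i)))
    (hB : IsLocalRing.maximalIdeal B ^ N₂ ≤
      (paramIdeal τ ϖ).map (MvPolynomial.aeval fun i => ψ (X i))) :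
    ∃ W : Submodule O (A ⊗[O] B), W.FG ∧ W ⊔ ((paramIdeal (σ ⊕ τ) ϖ).map
      (MvPolynomial.aeval (tensorParam φ ψ))).restrictScalars O = ⊤ := by
  obtain ⟨W₁, hW₁, h₁⟩ := IsLocalRing.exists_fg_sup_pow_maximalIdeal_eq_top hA' N₁
  obtain ⟨W₂, hW₂, h₂⟩ := IsLocalRing.exists_fg_sup_pow_maximalIdeal_eq_top hB' N₂
  refine ⟨Submodule.map₂ (TensorProduct.mk O A B) W₁ W₂, hW₁.map₂ _ hW₂, eq_top_iff.mpr ?_⟩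
  rintro c -
  induction c with
  | zero => exact zero_mem _
  | add x y hx hy => exact add_mem hx hy
  | tmul a b =>
    obtain ⟨w, hw, y, hy, rfl⟩ := Submodule.mem_sup.mp (h₁.ge (Submodule.mem_top (x := a)))
    obtain ⟨w', hw', y', hy', rfl⟩ := Submodule.mem_sup.mp (h₂.ge (Submodule.mem_top (x := b)))
    have hl : y ⊗ₜ[O] (1 : B) ∈ (paramIdeal (σ ⊕ τ) ϖ).map
        (MvPolynomial.aeval (tensorParam φ ψ)) :=
      map_includeLeft_paramIdeal_le ϖ (Ideal.mem_map_of_mem _ (hA hy))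
    have hr : (1 : A) ⊗ₜ[O] y' ∈ (paramIdeal (σ ⊕ τ) ϖ).map
        (MvPolynomial.aeval (tensorParam φ ψ)) :=
      map_includeRight_paramIdeal_le ϖ (Ideal.mem_map_of_mem _ (hB hy'))
    refine Submodule.mem_sup.mpr ⟨w ⊗ₜ w', Submodule.apply_mem_map₂ _ hw hw',
      w ⊗ₜ 1 * 1 ⊗ₜ y' + 1 ⊗ₜ (w' + y') * y ⊗ₜ 1,
      add_mem (Ideal.mul_mem_left _ _ hr) (Ideal.mul_mem_left _ _ hl), ?_⟩
    simp only [Algebra.TensorProduct.tmul_mul_tmul, mul_one, one_mul, TensorProduct.add_tmul,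
      TensorProduct.tmul_add, add_mul]
    abel

theorem finite_of_tensorParam [Finite σ] [Finite τ] [IsNoetherianRing A] [IsNoetherianRing B]
    [IsPrecomplete (Ideal.span {ϖ}) O]
    (hA' : Function.Surjective (algebraMap O (IsLocalRing.ResidueField A)))
    (hB' : Function.Surjective (algebraMap O (IsLocalRing.ResidueField B)))
    (hA : IsLocalRing.maximalIdeal A ^ N₁ ≤
      (paramIdeal σ ϖ).map (MvPolynomial.aeval fun i => φ (X i)))
    (hB : IsLocalRing.maximalIdeal B ^ N₂ ≤
      (paramIdeal τ ϖ).map (MvPolynomial.aeval fun i => ψ (X i)))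
    {R : Type*} [CommRing R] [Algebra O R] (h : A ⊗[O] B →ₐ[O] R)
    [IsHausdorff ((tensorMaximalIdeal O A B).map h) R]
    (happrox : ∀ k r, ∃ c, r - h c ∈ ((tensorMaximalIdeal O A B).map h) ^ k)
    {ev : MvPowerSeries (σ ⊕ τ) O →ₐ[O] R} (hev : ∀ i, ev (X i) = h (tensorParam φ ψ i))
    (hX : ∀ i, tensorParam φ ψ i ∈ tensorMaximalIdeal O A B)
    (hϖ : algebraMap O (A ⊗[O] B) ϖ ∈ tensorMaximalIdeal O A B) : ev.toRingHom.Finite := by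
  obtain ⟨W, hW, hWtop⟩ := exists_fg_sup_map_paramIdeal_eq_top hA' hB' hA hB
  have hmap : (paramIdeal (σ ⊕ τ) ϖ).map (MvPolynomial.aeval fun i => ev (X i)) =
      ((paramIdeal (σ ⊕ τ) ϖ).map (MvPolynomial.aeval (tensorParam φ ψ))).map h := by
    rw [map_aeval_paramIdeal, map_aeval_paramIdeal, Ideal.map_sup, Ideal.map_span, Ideal.map_span,
      Set.image_singleton, AlgHom.commutes, ← Set.range_comp]
    simp only [hev]
    rfl
  refine finite_of_span_sup_eq_top ϖ ((tensorMaximalIdeal O A B).map h) ev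
    (fun i => hev i ▸ Ideal.mem_map_of_mem _ (hX i))
    (h.commutes ϖ ▸ Ideal.mem_map_of_mem h hϖ) (W.map h.toLinearMap) (hW.map _)
    (eq_top_iff.mpr ?_)
  rintro r -
  rw [hmap]
  obtain ⟨c, hc⟩ := happrox (N₁ + N₂) r
  obtain ⟨w, hw, y, hy, rfl⟩ := Submodule.mem_sup.mp (hWtop.ge (Submodule.mem_top (x := c)))
  rw [← Ideal.map_pow] at hc
  refine Submodule.mem_sup.mpr ⟨h w, Submodule.mem_map_of_mem hw, h y + (r - h (w + y)),
    add_mem (Ideal.mem_map_of_mem h hy)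
      (Ideal.map_mono (tensorMaximalIdeal_pow_le hA hB) hc), ?_⟩
  rw [map_add]
  ring

end MvPowerSeries

/-- All that is needed of the completion: it is complete, C is dense, and its filtration induces
that of C. The main argument works for any R with these properties. -/
theorem AdicCompletion.exists_algHom {O C : Type*} [CommRing O] [CommRing C] [Algebra O C]
    {I : Ideal C} (hI : I.FG) :
    ∃ h : C →ₐ[O] AdicCompletion I C, IsAdicComplete (I.map h) (AdicCompletion I C) ∧
      (∀ k x, ∃ c, x - h c ∈ (I.map h) ^ k) ∧ ∀ k c, h c ∈ (I.map h) ^ k → c ∈ I ^ k :=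
  ⟨IsScalarTower.toAlgHom O C (AdicCompletion I C), isAdicComplete_map hI,
    exists_sub_algebraMap_mem hI, mem_pow_of_algebraMap_mem hI⟩

/-! ### Minimal primes of the completed tensor product and the conclusion -/

namespace MvPowerSeries

open IsLocalRing

variable {O A B : Type*} [CommRing O] [CommRing A] [IsLocalRing A] [CommRing B]
  [IsLocalRing B] [Algebra O A] [Algebra O B] {a b : ℕ}
  {φ : MvPowerSeries (Fin a) O →ₐ[O] A} {ψ : MvPowerSeries (Fin b) O →ₐ[O] B}

theorem ker_quotient_minimalPrime_eq_bot [IsDedekindDomain O] (hO : ringKrullDim O = 1)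
    (hA' : IsEquidimensional A) (hB' : IsEquidimensional B)
    (hφ : φ.toRingHom.Finite) (hψ : ψ.toRingHom.Finite)
    (hadim : ringKrullDim A = a + 1) (hbdim : ringKrullDim B = b + 1)
    (hφm : ∀ i, φ (X i) ∈ maximalIdeal A) (hψm : ∀ i, ψ (X i) ∈ maximalIdeal B) {ϖ : O}
    (hϖ : algebraMap O A ϖ ∈ maximalIdeal A) {N : ℕ}
    (hN : tensorMaximalIdeal O A B ^ N ≤
      (paramIdeal (Fin a ⊕ Fin b) ϖ).map (MvPolynomial.aeval (tensorParam φ ψ)))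
    {R : Type*} [CommRing R] [Algebra O R] [IsNoetherianRing R] (h : A ⊗[O] B →ₐ[O] R)
    (hjac : (tensorMaximalIdeal O A B).map h ≤ (⊥ : Ideal R).jacobson)
    (happrox : ∀ k r, ∃ c, r - h c ∈ ((tensorMaximalIdeal O A B).map h) ^ k)
    (hcomap : ∀ k c, h c ∈ ((tensorMaximalIdeal O A B).map h) ^ k →
      c ∈ tensorMaximalIdeal O A B ^ k)
    {ev : MvPowerSeries (Fin a ⊕ Fin b) O →ₐ[O] R}
    (hev : ∀ k u, ev u - h (MvPolynomial.aeval (tensorParam φ ψ) (truncTotal k u)) ∈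
      ((tensorMaximalIdeal O A B).map h) ^ k) {q : Ideal R} (hq : q ∈ minimalPrimes R) :
    RingHom.ker ((Ideal.Quotient.mk q).comp ev.toRingHom) = ⊥ := by
  have := hq.isPrime
  obtain ⟨P, hP, hPq⟩ := Ideal.exists_minimalPrimes_le (I := ⊥)
    (J := q.comap (h.comp (Algebra.TensorProduct.includeLeft : A →ₐ[O] A ⊗[O] B))) bot_le
  obtain ⟨Q, hQ, hQq⟩ := Ideal.exists_minimalPrimes_le (I := ⊥)
    (J := q.comap (h.comp (Algebra.TensorProduct.includeRight : B →ₐ[O] A ⊗[O] B))) bot_le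
  have := hP.isPrime
  have := hQ.isPrime
  obtain ⟨_, f, hf⟩ := exists_isFreeEmbedding_of_ringKrullDim_eq hO hφ P
    ((hA'.dim_quotient_eq P hP).trans hadim)
  obtain ⟨_, g, hg⟩ := exists_isFreeEmbedding_of_ringKrullDim_eq hO hψ Q
    ((hB'.dim_quotient_eq Q hQ).trans hbdim)
  let K : Ideal (A ⊗[O] B) := P.map (Algebra.TensorProduct.includeLeft : A →ₐ[O] A ⊗[O] B) ⊔
    Q.map (Algebra.TensorProduct.includeRight : B →ₐ[O] A ⊗[O] B)
  have hKq : K.map h ≤ q := by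
    rw [Ideal.map_le_iff_le_comap]
    exact sup_le (Ideal.map_le_iff_le_comap.mpr hPq) (Ideal.map_le_iff_le_comap.mpr hQq)
  -- A minimal prime of R containing KR is minimal over KR, so its elements are zero divisors modulo
  -- KR.
  have hqK : q ∈ (K.map h).minimalPrimes :=
    ⟨⟨hq.isPrime, hKq⟩, fun q' hq' hle => hq.2 ⟨hq'.1, bot_le⟩ hle⟩
  refine (Submodule.eq_bot_iff _).mpr fun u hu => by_contra fun hne => ?_
  have huq : ev u ∈ q := Ideal.Quotient.eq_zero_iff_mem.mp hu
  obtain ⟨y, hy, hyK⟩ := Ideal.exists_mul_mem_of_mem_minimalPrimes hqK huq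
  exact hy (Ideal.mem_of_forall_mem_sup_pow hjac _ fun i =>
    mem_sup_of_mul_mem hf hg hφm hψm hϖ rfl rfl hN h happrox hcomap hev hne hyK i)

end MvPowerSeries

open MvPowerSeries IsLocalRing in
theorem IsTorsionFreeCompleteLocalAlgebra.isEquidimensional_of_isAdicComplete
    {O A B : Type*} [CommRing O] [IsDedekindDomain O] [IsLocalRing O] [CommRing A] [IsLocalRing A]
    [CommRing B] [IsLocalRing B] [Algebra O A] [Algebra O B] (hO : ringKrullDim O = 1) {ϖ : O}
    (hϖ : ϖ ≠ 0) (hϖm : ϖ ∈ maximalIdeal O) [IsPrecomplete (Ideal.span {ϖ}) O]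
    (hA : IsTorsionFreeCompleteLocalAlgebra O A) (hB : IsTorsionFreeCompleteLocalAlgebra O B)
    (hA' : IsEquidimensional A) (hB' : IsEquidimensional B)
    {R : Type*} [CommRing R] [Algebra O R] (h : A ⊗[O] B →ₐ[O] R)
    [IsAdicComplete ((tensorMaximalIdeal O A B).map h) R]
    (happrox : ∀ k r, ∃ c, r - h c ∈ ((tensorMaximalIdeal O A B).map h) ^ k)
    (hcomap : ∀ k c, h c ∈ ((tensorMaximalIdeal O A B).map h) ^ k →
      c ∈ tensorMaximalIdeal O A B ^ k) :
    IsEquidimensional R ∧ ringKrullDim R + 1 = ringKrullDim A + ringKrullDim B := by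
  have := hA.noetherian
  have := hB.noetherian
  have hϖA := hA.algebraMap_mem_maximalIdeal hϖm
  have hϖB := hB.algebraMap_mem_maximalIdeal hϖm
  obtain ⟨a, φ, N₁, hφm, hφ, hadim, hN₁⟩ := hA.exists_finite_mvPowerSeries hϖ hϖA
  obtain ⟨b, ψ, N₂, hψm, hψ, hbdim, hN₂⟩ := hB.exists_finite_mvPowerSeries hϖ hϖB
  set I := tensorMaximalIdeal O A B
  have htp : ∀ i, tensorParam φ ψ i ∈ I := by
    rintro (i | i)
    · exact Ideal.mem_sup_left (Ideal.mem_map_of_mem _ (hφm i))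
    · exact Ideal.mem_sup_right (Ideal.mem_map_of_mem _ (hψm i))
  have hϖI : algebraMap O (A ⊗[O] B) ϖ ∈ I := by
    rw [← AlgHom.commutes (Algebra.TensorProduct.includeLeft : A →ₐ[O] A ⊗[O] B)]
    exact Ideal.mem_sup_left (Ideal.mem_map_of_mem _ hϖA)
  obtain ⟨ev, hevX, hev⟩ := exists_algHom_aeval_truncTotal (O := O) (I.map h)
    (fun i => h (tensorParam φ ψ i)) fun i => Ideal.mem_map_of_mem h (htp i)
  have hev' : ∀ k u, ev u - h (MvPolynomial.aeval (tensorParam φ ψ) (truncTotal k u)) ∈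
      (I.map h) ^ k := fun k u => by
    rw [MvPolynomial.comp_aeval_apply]
    exact hev k u
  have hfin : ev.toRingHom.Finite :=
    finite_of_tensorParam hA.residueField hB.residueField hN₁ hN₂ h happrox hevX htp hϖI
  let _ : Algebra (MvPowerSeries (Fin a ⊕ Fin b) O) R := ev.toRingHom.toAlgebra
  have : Module.Finite (MvPowerSeries (Fin a ⊕ Fin b) O) R := hfin
  have : IsNoetherianRing R := IsNoetherianRing.of_finite
    (MvPowerSeries (Fin a ⊕ Fin b) O) R
  have : Nontrivial R := by
    refine ⟨0, 1, fun h01 => hA.tensorMaximalIdeal_ne_top hB ((Ideal.eq_top_iff_one _).mpr ?_)⟩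
    rw [← pow_one (tensorMaximalIdeal O A B)]
    refine hcomap 1 1 ?_
    rw [map_one, ← h01]
    exact zero_mem _
  have hU : ringKrullDim (MvPowerSeries (Fin a ⊕ Fin b) O) = (a + b + 1 : ℕ) := by
    rw [ringKrullDim_eq_add_card, hO, Nat.card_sum, Nat.card_fin, Nat.card_fin]
    push_cast
    ring
  have hquot (q : Ideal R) (hq : q ∈ minimalPrimes R) :
      ringKrullDim (R ⧸ q) = (a + b + 1 : ℕ) := by
    rw [← hU]
    refine RingHom.ringKrullDim_eq_of_isIntegral_of_injective
      ((Ideal.Quotient.mk q).comp ev.toRingHom)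
      ((RingHom.Finite.of_surjective _ Ideal.Quotient.mk_surjective).comp hfin).to_isIntegral ?_
    rw [RingHom.injective_iff_ker_eq_bot]
    exact ker_quotient_minimalPrime_eq_bot hO hA' hB' hφ hψ hadim hbdim hφm hψm hϖA
      (tensorMaximalIdeal_pow_le hN₁ hN₂) h (IsAdicComplete.le_jacobson_bot _) happrox hcomap hev' hq
  -- Integrality over the power series ring bounds the dimension above; any minimal prime, available
  -- as R ≠ 0, bounds it below.
  have hdim : ringKrullDim R = (a + b + 1 : ℕ) := by
    refine le_antisymm ((ringKrullDim_le_of_isIntegral (MvPowerSeries (Fin a ⊕ Fin b) O) R).trans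
      hU.le) ?_
    obtain ⟨q, hq⟩ := Ideal.nonempty_minimalPrimes (I := (⊥ : Ideal R)) bot_ne_top
    exact (hquot q hq).symm.le.trans (ringKrullDim_quotient_le q)
  refine ⟨⟨.of_eq_natCast hdim, fun q hq => (hquot q hq).trans hdim.symm⟩, ?_⟩
  rw [hdim, hadim, hbdim]
  push_cast
  abel

theorem IsTorsionFreeCompleteLocalAlgebra.isEquidimensional_completedTensorProduct
    {O A B : Type*} [CommRing O] [IsDedekindDomain O] [IsLocalRing O] [CommRing A] [IsLocalRing A]
    [CommRing B] [IsLocalRing B] [Algebra O A] [Algebra O B] (hO : ringKrullDim O = 1) {ϖ : O}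
    (hϖ : ϖ ≠ 0) (hϖm : ϖ ∈ IsLocalRing.maximalIdeal O) [IsPrecomplete (Ideal.span {ϖ}) O]
    (hA : IsTorsionFreeCompleteLocalAlgebra O A) (hB : IsTorsionFreeCompleteLocalAlgebra O B)
    (hA' : IsEquidimensional A) (hB' : IsEquidimensional B) :
    IsEquidimensional (CompletedTensorProduct O A B) ∧
      ringKrullDim (CompletedTensorProduct O A B) + 1 = ringKrullDim A + ringKrullDim B := by
  have := hA.noetherian
  have := hB.noetherian
  have hFG : (tensorMaximalIdeal O A B).FG :=
    Submodule.FG.sup (Ideal.FG.map (IsLocalRing.maximalIdeal A).fg_of_isNoetherianRing _)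
      (Ideal.FG.map (IsLocalRing.maximalIdeal B).fg_of_isNoetherianRing _)
  obtain ⟨h, _, happrox, hcomap⟩ := AdicCompletion.exists_algHom (O := O) hFG
  exact hA.isEquidimensional_of_isAdicComplete hO hϖ hϖm hB hA' hB' h happrox hcomap

theorem mainTheorem12 (p : ℕ) [Fact p.Prime] (L : Type*) [Field L] [Algebra ℚ_[p] L]
    [FiniteDimensional ℚ_[p] L] [Algebra ℤ_[p] L] [IsScalarTower ℤ_[p] ℚ_[p] L]
    (A B : Type*) [CommRing A] [CommRing B] [IsLocalRing A] [IsLocalRing B]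
    [Algebra (PadicIntegers p L) A] [Algebra (PadicIntegers p L) B]
    (hA : IsTorsionFreeCompleteLocalAlgebra (PadicIntegers p L) A)
    (hB : IsTorsionFreeCompleteLocalAlgebra (PadicIntegers p L) B)
    (hA' : IsEquidimensional A) (hB' : IsEquidimensional B) :
    IsEquidimensional (CompletedTensorProduct (PadicIntegers p L) A B) ∧
      ringKrullDim (CompletedTensorProduct (PadicIntegers p L) A B) + 1 =
        ringKrullDim A + ringKrullDim B := by
  have := PadicIntegers.isDedekindDomain p L
  have := PadicIntegers.isLocalRing p L
  have := PadicIntegers.isAdicComplete p L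
  refine IsTorsionFreeCompleteLocalAlgebra.isEquidimensional_completedTensorProduct
    (PadicIntegers.ringKrullDim_eq_one p L) (PadicIntegers.natCast_ne_zero p L) ?_ hA hB hA' hB'
  rw [← IsLocalRing.jacobson_eq_maximalIdeal ⊥ bot_ne_top]
  exact IsAdicComplete.le_jacobson_bot _ (Ideal.mem_span_singleton_self _)
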